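/- Let $\mathbb{K}$ be a field and use the lexicographic order on $\mathbb{K}[x,y]$ with $y \succ x$. Fix monomials $E=(y^{n_0}, x^{m_1}y^{n_1},\dots,x^{m_{s-1}}y^{n_{s-1}},x^{m_s})$ with $0=m_0<m_1<\cdots<m_s$ and $n_0>n_1>\cdots>n_s=0$, and put $d_i=m_i-m_{i-1}$, $e_i=n_{i-1}-n_i$ for $1\le i\le s$. Let $\mu_1,\dots,\mu_\delta$ be the monomials not in $\langle E\rangle$, and let the Gröbner cell $\mathcal{C}(E)$ be the set of ideals of $\mathbb{K}[x,y]$ whose initial ideal is $\langle E\rangle$. Gröbner parameters. For a commutative ring $R$, consider polynomials $\sigma_{j,i}\in R[x,y]$, $0\le i\le s-1$, $i\le j\le s$, with $\deg_x\sigma_{j,i}<d_{i+1}$, with $\sigma_{i,i}\in R[x]$, and with $\deg_y\sigma_{j,i}<e_j$ for $j>i$. They have $N=\delta+m_s$ coefficients in total, and we identify such a family with the vector $c\in R^N$ of its coefficients. Let $h_0,\dots,h_s\in R[x,y]$ be the polynomials determined by $h_s=\prod_{i=1}^{s}(x^{d_i}-\sigma_{i-1,i-1})$ and, for $0\le i\le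 s-1$, $$x^{d_{i+1}}h_i-y^{e_{i+1}}h_{i+1}=\sigma_{i,i}h_i+\sigma_{i+1,i}h_{i+1}+\cdots+\sigma_{s,i}h_s ,$$ and let $\Phi_E(c)=\langle h_0,\dots,h_s\rangle$. Equations. Let $\Lambda=(\Lambda_1,\dots,\Lambda_N)$ be new variables, $\mathbb{L}=\mathbb{K}(\Lambda)$, and let $\Phi_E(\Lambda)\subset\mathbb{L}[x,y]$ be the ideal generated by the generic Gröbner basis of the cell, that is, by the $h_i$ with parameters $c=\Lambda$. The normal form of $A\in\mathbb{K}[x,y]$ is the element of $A+\Phi_E(\Lambda)$ that is an $\mathbb{L}$-linear combination of $\mu_1,\dots,\mu_\delta$. Proposition. Let $I\in\mathcal{C}(E)$, let $f_1,\dots,f_t\in\mathbb{K}[x,y]$, $J=\langle f_1,\dots,f_t\rangle$, and suppose that there is an ideal $I'\subset\mathbb{K}[x,y]$ with $I+I'=\langle 1\rangle$ and $I I'=J$. Then: 1. there is exactly one $\lambda\in\mathbb{K}^N$ with $\Phi_E(\lambda)=I$ (the Gröbner parameters of $I$); 2. there is exactly one family $(\mathscr{E}_{i,j})_{1\le i\le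 t,\,1\le j\le\delta}$ of polynomials in $\mathbb{K}[\Lambda]$ such that, for all $i$, $\sum_j\mathscr{E}_{i,j}\,\mu_j$ is the normal form of $f_i$; 3. $\lambda$ is a solution of multiplicity one of the equations $\mathscr{E}_{1,1},\dots,\mathscr{E}_{t,\delta}$: we have $\mathscr{E}_{i,j}(\lambda)=0$ for all $i,j$, the local algebra $\mathbb{K}[\Lambda]_{\mathfrak{m}_\lambda}/\langle\mathscr{E}_{1,1},\dots,\mathscr{E}_{t,\delta}\rangle$, with $\mathfrak{m}_\lambda=\langle\Lambda_1-\lambda_1,\dots,\Lambda_N-\lambda_N\rangle$, has dimension $1$ over $\mathbb{K}$, and the Jacobian matrix of the $\mathscr{E}_{i,j}$ with respect to $\Lambda_1,\dots,\Lambda_N$ at $\lambda$ has trivial kernel. -/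

import Mathlib

open Polynomial
open scoped Polynomial.Bivariate

/-- The data `(m_i, n_i)`, `0 ≤ i ≤ s`, of a tuple of monomials
`E = (y^{n_0}, x^{m_1} y^{n_1}, …, x^{m_s})` which minimally generate a monomial ideal of
finite colength: the `m_i` increase from `m_0 = 0`, the `n_i` decrease to `n_s = 0`. -/
structure Staircase where
  s : ℕ
  m : Fin (s + 1) → ℕ
  n : Fin (s + 1) → ℕ
  m_zero : m 0 = 0
  n_last : n (Fin.last s) = 0
  m_strictMono : StrictMono m
  n_strictAnti : StrictAnti n

/-- The initial ideal of `I` for the lexicographic order with `y ≻ x`. In `K[X][Y]` the outer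
variable is `y`, so the initial monomial of `p ≠ 0` is `x ^ a * y ^ b`, with `b` the `y`-degree
of `p` and `a` the degree of the coefficient of `y ^ b` in `p`, a polynomial in `x`. -/
noncomputable def initialIdeal {K : Type*} [Field K] (I : Ideal K[X][Y]) : Ideal K[X][Y] :=
  Ideal.span {q | ∃ p ∈ I, p ≠ 0 ∧ q = C (X ^ p.leadingCoeff.natDegree) * Y ^ p.natDegree}

namespace Staircase

/-- `E.d i` is `d_{i+1} = m_{i+1} - m_i`, for `0 ≤ i < s`. -/
def d (E : Staircase) (i : Fin E.s) : ℕ := E.m i.succ - E.m i.castSucc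

/-- `E.e i` is `e_{i+1} = n_i - n_{i+1}`, for `0 ≤ i < s`. -/
def e (E : Staircase) (i : Fin E.s) : ℕ := E.n i.castSucc - E.n i.succ

/-- The ideal generated by the monomials `x ^ m_i * y ^ n_i`. -/
noncomputable def monomialIdeal (E : Staircase) (K : Type*) [Field K] : Ideal K[X][Y] :=
  Ideal.span (Set.range fun i => C (X ^ E.m i) * Y ^ E.n i)

/-- The Gröbner cell of `E`. -/
def cell (E : Staircase) (K : Type*) [Field K] : Set (Ideal K[X][Y]) :=
  {I | initialIdeal I = E.monomialIdeal K}

/-- The initial segment determined by `E`: the exponents `(a, b)` of the monomials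
`x ^ a * y ^ b` that are divisible by no `x ^ m_i * y ^ n_i`. -/
def segment (E : Staircase) : Set (ℕ × ℕ) :=
  {μ | ∀ i, ¬ (E.m i ≤ μ.1 ∧ E.n i ≤ μ.2)}

/-- The index set of the Gröbner parameters. `Sum.inl ⟨i, l⟩` is the index of the coefficient of
`x ^ l` in `σ_{i,i}`, and `Sum.inr ⟨i, j, l, k⟩`, with `i ≤ j < s`, that of the coefficient of
`x ^ l * y ^ k` in `σ_{j+1,i}`; here `l < d_{i+1}` and `k < e_{j+1}`. -/
abbrev Param (E : Staircase) : Type :=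
  (Σ i : Fin E.s, Fin (E.d i)) ⊕ (Σ i : Fin E.s, Σ j : Set.Ici i, Fin (E.d i) × Fin (E.e j))

variable {R : Type*} [CommRing R]

/-- The polynomial `σ_{i,i}` in `R[x]`. -/
noncomputable def sigmaDiag (E : Staircase) (c : E.Param → R) (i : Fin E.s) : R[X] :=
  ∑ l : Fin (E.d i), C (c (Sum.inl ⟨i, l⟩)) * X ^ (l : ℕ)

/-- The polynomial `σ_{j+1,i}` in `R[x,y]`, for `i ≤ j < s`. -/
noncomputable def sigma (E : Staircase) (c : E.Param → R) (i : Fin E.s) (j : Set.Ici i) :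
    R[X][Y] :=
  ∑ l : Fin (E.d i), ∑ k : Fin (E.e j),
    C (C (c (Sum.inr ⟨i, j, l, k⟩)) * X ^ (l : ℕ)) * Y ^ (k : ℕ)

/-- `E.D c i` is the polynomial `D_{i+1} = x ^ d_{i+1} - σ_{i,i}`. -/
noncomputable def D (E : Staircase) (c : E.Param → R) (i : Fin E.s) : R[X] :=
  X ^ E.d i - E.sigmaDiag c i

/-- `M_i = D_1 ⋯ D_i`. -/
noncomputable def M (E : Staircase) (c : E.Param → R) (i : Fin (E.s + 1)) : R[X] :=
  ∏ k : Fin E.s with k.castSucc < i, E.D c k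

/-- The quotients `h_i / M_i`, by descending recursion on `i`. -/
noncomputable def cofactor (E : Staircase) (c : E.Param → R) (i : Fin (E.s + 1)) : R[X][Y] :=
  if hi : (i : ℕ) < E.s then
    Y ^ E.e ⟨i, hi⟩ * cofactor E c (Fin.succ ⟨i, hi⟩) +
      ∑ j : Set.Ici (⟨i, hi⟩ : Fin E.s),
        E.sigma c ⟨i, hi⟩ j * C (∏ k ∈ Finset.Ioc ⟨i, hi⟩ j.1, E.D c k) *
          cofactor E c (Fin.succ j.1)
  else 1
termination_by E.s - i
decreasing_by
  · simp only [Fin.succ_mk]; omega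
  · have h1 : (i : ℕ) ≤ (j.1 : ℕ) := j.2
    simp only [Fin.val_succ]; omega

/-- The polynomials `h_0, …, h_s` with parameters `c`; see `basis_last`, `basis_syzygy` and
`eq_basis` for the relations which define them. -/
noncomputable def basis (E : Staircase) (c : E.Param → R) (i : Fin (E.s + 1)) : R[X][Y] :=
  C (E.M c i) * E.cofactor c i

theorem basis_last (E : Staircase) (c : E.Param → R) :
    E.basis c (Fin.last E.s) = C (∏ i, E.D c i) := by
  have : E.cofactor c (Fin.last E.s) = 1 := by
    rw [cofactor]; simp
  rw [basis, this, mul_one, M]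
  congr 2
  ext k
  simp [Fin.castSucc_lt_last]

theorem M_succ (E : Staircase) (c : E.Param → R) (i j : Fin E.s) (hij : i ≤ j) :
    E.M c j.succ = E.D c i * E.M c i.castSucc * ∏ k ∈ Finset.Ioc i j, E.D c k := by
  classical
  rw [M, M]
  have h1 : (Finset.univ.filter fun k : Fin E.s => k.castSucc < j.succ) =
      insert i (Finset.univ.filter fun k : Fin E.s => k.castSucc < i.castSucc) ∪
        Finset.Ioc i j := by
    ext k
    simp only [Finset.mem_filter, Finset.mem_univ, true_and, Finset.mem_union, Finset.mem_insert,
      Finset.mem_Ioc, Fin.lt_def, Fin.le_def, Fin.ext_iff, Fin.val_castSucc, Fin.val_succ] at *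
    omega
  have h2 : Disjoint (insert i (Finset.univ.filter fun k : Fin E.s => k.castSucc < i.castSucc))
      (Finset.Ioc i j) := by
    rw [Finset.disjoint_left]
    intro k
    simp only [Finset.mem_filter, Finset.mem_univ, true_and, Finset.mem_insert,
      Finset.mem_Ioc, Fin.lt_def, Fin.le_def, Fin.ext_iff, Fin.val_castSucc]
    omega
  rw [h1, Finset.prod_union h2, Finset.prod_insert (by simp)]

theorem basis_syzygy (E : Staircase) (c : E.Param → R) (i : Fin E.s) :
    C (X ^ E.d i) * E.basis c i.castSucc - Y ^ E.e i * E.basis c i.succ =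
      C (E.sigmaDiag c i) * E.basis c i.castSucc +
        ∑ j : Set.Ici i, E.sigma c i j * E.basis c (Fin.succ j.1) := by
  have hc : E.cofactor c i.castSucc = Y ^ E.e i * E.cofactor c i.succ +
      ∑ j : Set.Ici i, E.sigma c i j * C (∏ k ∈ Finset.Ioc i j.1, E.D c k) *
          E.cofactor c (Fin.succ j.1) := by
    rw [cofactor, dif_pos (show ((i.castSucc : Fin _) : ℕ) < E.s from i.isLt)]
    rfl
  have hX : (C (X ^ E.d i) : R[X][Y]) = C (E.D c i) + C (E.sigmaDiag c i) := by
    rw [← C_add, D]; congr 1; ring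
  have key : C (E.D c i) * E.basis c i.castSucc = Y ^ E.e i * E.basis c i.succ +
      ∑ j : Set.Ici i, E.sigma c i j * E.basis c (Fin.succ j.1) := by
    have h0 : E.M c i.succ = E.D c i * E.M c i.castSucc := by
      simpa using E.M_succ c i i le_rfl
    simp only [basis]
    rw [hc, h0, mul_add, mul_add, Finset.mul_sum, Finset.mul_sum]
    refine congrArg₂ (fun p q : R[X][Y] => p + q) ?_ (Finset.sum_congr rfl fun j _ => ?_)
    · generalize E.cofactor c i.succ = u
      rw [C_mul]; ring
    · rw [E.M_succ c i j.1 j.2]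
      generalize E.cofactor c (Fin.succ j.1) = u
      generalize ∏ k ∈ Finset.Ioc i j.1, E.D c k = w
      rw [C_mul, C_mul]; ring
  rw [hX, add_mul, key]; ring

theorem D_monic (E : Staircase) (c : E.Param → R) (i : Fin E.s) : (E.D c i).Monic := by
  rcases subsingleton_or_nontrivial R with h | h
  · exact Subsingleton.elim _ _
  refine monic_X_pow_sub ?_
  rw [sigmaDiag]
  refine (degree_sum_le _ _).trans_lt ?_
  rw [Finset.sup_lt_iff (WithBot.bot_lt_coe _)]
  intro l _
  refine (degree_C_mul_X_pow_le _ _).trans_lt ?_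
  exact_mod_cast l.isLt

/-- The relations determine `h_0, …, h_s`. -/
theorem eq_basis (E : Staircase) (c : E.Param → R) (h : Fin (E.s + 1) → R[X][Y])
    (h_last : h (Fin.last E.s) = C (∏ i, E.D c i))
    (h_syzygy : ∀ i : Fin E.s, C (X ^ E.d i) * h i.castSucc - Y ^ E.e i * h i.succ =
      C (E.sigmaDiag c i) * h i.castSucc +
        ∑ j : Set.Ici i, E.sigma c i j * h (Fin.succ j.1)) :
    h = E.basis c := by
  have main : ∀ k : ℕ, ∀ i : Fin (E.s + 1), E.s - i ≤ k → h i = E.basis c i := by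
    intro k
    induction k with
    | zero =>
      intro i hi
      have : i = Fin.last E.s := by
        ext; have := i.isLt; simp only [Fin.val_last]; omega
      rw [this, h_last, basis_last]
    | succ k ih =>
      intro i
      refine Fin.lastCases ?_ (fun i => ?_) i
      · intro _; rw [h_last, basis_last]
      · intro hi
        simp only [Fin.val_castSucc] at hi
        have h1 := h_syzygy i
        have h2 := E.basis_syzygy c i
        rw [ih i.succ (by simp only [Fin.val_succ]; omega)] at h1
        have h3 : ∑ j : Set.Ici i, E.sigma c i j * h (Fin.succ j.1) =
            ∑ j : Set.Ici i, E.sigma c i j * E.basis c (Fin.succ j.1) := by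
          refine Finset.sum_congr rfl fun j _ => ?_
          rw [ih (Fin.succ j.1)]
          have hj : (i : ℕ) ≤ (j.1 : ℕ) := j.2
          simp only [Fin.val_succ]; omega
        rw [h3] at h1
        have hX : (C (X ^ E.d i) : R[X][Y]) = C (E.D c i) + C (E.sigmaDiag c i) := by
          rw [← C_add, D]; congr 1; ring
        rw [hX] at h1 h2
        have hm : C (E.D c i) * (h i.castSucc - E.basis c i.castSucc) = 0 := by
          linear_combination h1 - h2
        have : h i.castSucc - E.basis c i.castSucc = 0 := by
          ext1 b
          have hb := congrArg (fun p => p.coeff b) hm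
          simp only [coeff_C_mul, coeff_zero] at hb
          rw [coeff_zero]
          exact (E.D_monic c i).mul_right_eq_zero_iff.mp hb
        exact sub_eq_zero.mp this
  funext i
  exact main _ i le_rfl

/-- The ideal `⟨h_0, …, h_s⟩` with parameters `c`; over a field, this is the value at `c` of the
parametrization of the Gröbner cell of `E`. -/
noncomputable def paramIdeal (E : Staircase) (c : E.Param → R) : Ideal R[X][Y] :=
  Ideal.span (Set.range (E.basis c))

/-- `r` is the normal form of `A` modulo `I`, for `I` in the Gröbner cell of `E`: it is
congruent to `A` modulo `I`, and all its monomials have exponents in the initial segment. -/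
def IsNormalForm (E : Staircase) (I : Ideal R[X][Y]) (A r : R[X][Y]) : Prop :=
  A - r ∈ I ∧ ∀ a b : ℕ, (r.coeff b).coeff a ≠ 0 → (a, b) ∈ E.segment

/-- The ideal generated by the generic Gröbner basis, in `L[x,y]` with `L = K(Λ)` and one
variable `Λ_p` for each Gröbner parameter `p`. The basis `h_0, …, h_s` need not be reduced, but
inter-reducing it changes neither this ideal nor the normal forms modulo it. -/
noncomputable def genericIdeal (E : Staircase) (K : Type*) [Field K] :
    Ideal (FractionRing (MvPolynomial E.Param K))[X][Y] :=
  E.paramIdeal fun p => algebraMap (MvPolynomial E.Param K) _ (MvPolynomial.X p)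

/-- `eqs i μ`, which lies in `K[Λ]`, is the coefficient at the monomial `μ` of the normal form
of `f i` modulo the generic Gröbner basis, for all `i` and all `μ` in the initial segment. -/
def IsEquations (E : Staircase) {K : Type*} [Field K] {t : ℕ} (f : Fin t → K[X][Y])
    (eqs : Fin t → E.segment → MvPolynomial E.Param K) : Prop :=
  ∀ i, ∃ r, E.IsNormalForm (E.genericIdeal K)
      ((f i).map (mapRingHom (algebraMap K (FractionRing (MvPolynomial E.Param K))))) r ∧
    ∀ μ : E.segment, algebraMap _ _ (eqs i μ) = (r.coeff μ.1.2).coeff μ.1.1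

end Staircase

/-- The ideal of all polynomials that vanish at the point `a`. -/
noncomputable def pointIdeal {K : Type*} [Field K] {P : Type*} (a : P → K) :
    Ideal (MvPolynomial P K) :=
  RingHom.ker (MvPolynomial.eval a)

instance pointIdeal_isPrime {K : Type*} [Field K] {P : Type*} (a : P → K) :
    (pointIdeal a).IsPrime :=
  RingHom.ker_isPrime _

/-- The multiplicity of a point `a` as a solution of the system `F = 0`: the dimension over `K`
of the local algebra `K[Λ]_𝔪 / ⟨F⟩`, where `𝔪` is the maximal ideal of the polynomials that
vanish at `a`. (It is zero if `a` is not a solution.) -/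
noncomputable def solutionMultiplicity {K : Type*} [Field K] {ι P : Type*}
    (F : ι → MvPolynomial P K) (a : P → K) : ℕ :=
  Module.finrank K
    (Localization.AtPrime (pointIdeal a) ⧸ (Ideal.span (Set.range F)).map
      (algebraMap (MvPolynomial P K) (Localization.AtPrime (pointIdeal a))))

/-- The Jacobian matrix of the system `F` at the point `a`. -/
noncomputable def jacobianMatrix {K : Type*} [Field K] {ι P : Type*}
    (F : ι → MvPolynomial P K) (a : P → K) : Matrix ι P K :=
  Matrix.of fun i p => MvPolynomial.eval a (MvPolynomial.pderiv p (F i))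

/-! Over every nontrivial ring `R`, `⟨h_0, …, h_s⟩` is free over `R[x]`, with one basis element in
each `y`-degree `b`. Its coefficient of `y ^ b` is monic in `x`, of degree equal to the width of the
staircase at height `b`. Division by this basis therefore needs no denominators. It gives unique
normal forms supported on the initial segment, and these commute with base change. Hence the
equations have coefficients in `K[Λ]`, and a homomorphism `φ : K[Λ] → R` kills those of `f_i` iff
`f_i` lies in the ideal with parameters `φ(Λ)` (`IsEquations.forall_eq_zero_iff`).

Comparing expansions in this basis shows that the ideal determines the parameters, over `R` as well
(`paramIdeal_injective`). For an ideal of the cell, the leading coefficients in `x` give the `D_i`,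
and division by `D_i` gives the remaining rows of parameters (`exists_paramIdeal_eq`).

For multiplicity one, let `𝔪` be the maximal ideal of `λ` and take `R = K[Λ] / (⟨equations⟩ + 𝔪²)`.
The class of `Λ` is a square-zero deformation of `λ` whose ideal contains `J`. Since `I + I' = 1`,
some `u ∈ I'` is `1` modulo `I`, and it remains a unit modulo the deformed ideal. From `I u ⊆ J` it
follows that `I` lies in the deformed ideal, so the deformation is trivial
(`eq_of_map_le_paramIdeal`). Thus `𝔪 ⊆ ⟨equations⟩ + 𝔪²`. Nakayama's lemma then gives the local
algebra, and the product rule the kernel of the Jacobian matrix. -/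

namespace Polynomial

/-! ### Division by a family with one member in each `y`-degree -/

variable {R : Type*} [CommRing R] {B : ℕ → R[X][Y]} {δ : ℕ → ℕ}

/-- Division by a family with one member of each `y`-degree, whose leading coefficients are
monic polynomials in `x`. -/
theorem exists_sub_sum_coeff_degree_lt [Nontrivial R] (hdeg : ∀ b, (B b).natDegree ≤ b)
    (hB : ∀ b, IsMonicOfDegree ((B b).coeff b) (δ b)) (n : ℕ) (f : R[X][Y]) (hf : f.degree < n) :
    ∃ q : ℕ → R[X], ∀ b,
      ((f - ∑ b ∈ Finset.range n, C (q b) * B b).coeff b).degree < (δ b : WithBot ℕ) := by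
  induction n generalizing f with
  | zero =>
    refine ⟨0, fun b => ?_⟩
    have : f = 0 := by simpa [Polynomial.degree_lt_iff_coeff_zero, Polynomial.ext_iff] using hf
    simp [this]
  | succ n ih =>
    obtain ⟨p, r, hpr, hrdeg⟩ : ∃ p r : R[X], f.coeff n = r + (B n).coeff n * p ∧
        r.degree < (δ n : WithBot ℕ) := by
      refine ⟨_, _, (modByMonic_add_div (f.coeff n) ((B n).coeff n)).symm, ?_⟩
      have := degree_modByMonic_lt (f.coeff n) (hB n).monic
      rwa [degree_eq_natDegree (hB n).ne_zero, (hB n).natDegree_eq] at this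
    -- The term `r * y ^ n` is already reduced; setting it aside leaves a polynomial of smaller
    -- degree.
    have hlow : (f - C p * B n - monomial n r).degree < n := by
      rw [degree_lt_iff_coeff_zero] at hf ⊢
      intro k hk
      rcases hk.eq_or_lt with rfl | hk
      · simp only [coeff_sub, coeff_C_mul, coeff_monomial, if_true, hpr]
        ring
      · simp only [coeff_sub, coeff_C_mul, coeff_monomial, if_neg hk.ne,
          coeff_eq_zero_of_natDegree_lt ((hdeg n).trans_lt hk), hf k hk]
        ring
    obtain ⟨q, hq⟩ := ih _ hlow
    refine ⟨fun b => if b = n then p else q b, fun b => ?_⟩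
    have hsum : ∑ b ∈ Finset.range (n + 1), C (if b = n then p else q b) * B b =
        ∑ b ∈ Finset.range n, C (q b) * B b + C p * B n := by
      rw [Finset.sum_range_succ, if_pos rfl]
      congr 1
      refine Finset.sum_congr rfl fun b hb => ?_
      rw [if_neg (Finset.mem_range.mp hb).ne]
    have hsplit : f - ∑ b ∈ Finset.range (n + 1), C (if b = n then p else q b) * B b =
        (f - C p * B n - monomial n r - ∑ b ∈ Finset.range n, C (q b) * B b) + monomial n r := by
      rw [hsum]; ring
    rw [hsplit, coeff_add]
    refine (degree_add_le _ _).trans_lt (max_lt (hq b) ?_)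
    rw [coeff_monomial]
    split_ifs with h
    · exact h ▸ hrdeg
    · simp

/-- Only the last member reaches the top `y`-degree, and a nonzero multiple of its monic coefficient
is too large in `x` to be reduced; descend from there. -/
theorem eq_zero_of_sum_coeff_degree_lt [Nontrivial R] (hdeg : ∀ b, (B b).natDegree ≤ b)
    (hB : ∀ b, IsMonicOfDegree ((B b).coeff b) (δ b)) (n : ℕ) (q : ℕ → R[X])
    (h : ∀ b, ((∑ b ∈ Finset.range n, C (q b) * B b).coeff b).degree < (δ b : WithBot ℕ)) :
    ∀ b < n, q b = 0 := by
  induction n with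
  | zero => simp
  | succ n ih =>
    have htop : q n = 0 := by
      have h1 := h n
      have h2 : (∑ b ∈ Finset.range (n + 1), C (q b) * B b).coeff n = q n * (B n).coeff n := by
        rw [finsetSum_coeff, Finset.sum_range_succ, coeff_C_mul, Finset.sum_eq_zero, zero_add]
        intro b hb
        rw [coeff_C_mul, coeff_eq_zero_of_natDegree_lt
          ((hdeg b).trans_lt (Finset.mem_range.mp hb)), mul_zero]
      by_contra hne
      rw [h2, (hB n).monic.degree_mul, degree_eq_natDegree hne,
        degree_eq_natDegree (hB n).ne_zero, (hB n).natDegree_eq] at h1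
      norm_cast at h1
      omega
    intro b hb
    rcases Nat.lt_succ_iff_lt_or_eq.mp hb with hb | rfl
    · refine ih (fun b => ?_) b hb
      have := h b
      rwa [Finset.sum_range_succ, htop, C_0, zero_mul, add_zero] at this
    · exact htop

end Polynomial

/-! ### Combinatorics of the staircase -/

namespace Staircase

/-- The least `i` with `n_i ≤ b`. -/
noncomputable def idx (E : Staircase) (b : ℕ) : Fin (E.s + 1) :=
  (Finset.univ.filter fun i => E.n i ≤ b).min' ⟨Fin.last _, by simp [E.n_last]⟩

variable (E : Staircase)

theorem n_idx_le (b : ℕ) : E.n (E.idx b) ≤ b :=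
  (Finset.mem_filter.mp (Finset.min'_mem (Finset.univ.filter fun i => E.n i ≤ b) _)).2

theorem idx_le_iff {b : ℕ} {i : Fin (E.s + 1)} : E.idx b ≤ i ↔ E.n i ≤ b := by
  refine ⟨fun h => (E.n_strictAnti.antitone h).trans (E.n_idx_le b), fun h => ?_⟩
  exact Finset.min'_le _ _ (by simpa using h)

theorem idx_n (i : Fin (E.s + 1)) : E.idx (E.n i) = i :=
  le_antisymm (E.idx_le_iff.mpr le_rfl) (E.n_strictAnti.le_iff_ge.mp (E.n_idx_le _))

theorem d_pos (i : Fin E.s) : 0 < E.d i :=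
  Nat.sub_pos_of_lt (E.m_strictMono Fin.castSucc_lt_succ)

theorem e_pos (i : Fin E.s) : 0 < E.e i :=
  Nat.sub_pos_of_lt (E.n_strictAnti Fin.castSucc_lt_succ)

theorem n_castSucc (i : Fin E.s) : E.n i.castSucc = E.n i.succ + E.e i := by
  have := E.n_strictAnti (Fin.castSucc_lt_succ (i := i))
  rw [e]; omega

theorem m_succ (i : Fin E.s) : E.m i.succ = E.d i + E.m i.castSucc := by
  have := E.m_strictMono (Fin.castSucc_lt_succ (i := i))
  rw [d]; omega

theorem idx_n_succ_add (i : Fin E.s) {k : ℕ} (hk : k < E.e i) :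
    E.idx (E.n i.succ + k) = i.succ := by
  refine le_antisymm (E.idx_le_iff.mpr (Nat.le_add_right _ _)) ?_
  rw [← Fin.castSucc_lt_iff_succ_le, ← not_le, E.idx_le_iff, E.n_castSucc]
  omega

/-- Among the corners of height at most `b`, the one of least index is leftmost, so it alone
decides. -/
theorem mem_segment_iff {a b : ℕ} : (a, b) ∈ E.segment ↔ a < E.m (E.idx b) := by
  refine ⟨fun h => ?_, fun h i hi => ?_⟩
  · by_contra hab
    exact h (E.idx b) ⟨not_lt.mp hab, E.n_idx_le b⟩
  · exact (h.trans_le (E.m_strictMono.monotone (E.idx_le_iff.mpr hi.2))).not_ge hi.1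

theorem forall_mem_segment_iff {R : Type*} [CommRing R] {r : R[X][Y]} :
    (∀ a b : ℕ, (r.coeff b).coeff a ≠ 0 → (a, b) ∈ E.segment) ↔
      ∀ b, (r.coeff b).degree < (E.m (E.idx b) : WithBot ℕ) := by
  simp only [mem_segment_iff, degree_lt_iff_coeff_zero]
  refine ⟨fun h b a ha => ?_, fun h a b hab => ?_⟩
  · by_contra h0
    exact (h a b h0).not_ge ha
  · by_contra h0
    exact hab (h b a (not_lt.mp h0))

theorem n_succ_add_lt (i : Fin E.s) (j : Set.Ici i) (k : Fin (E.e j)) :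
    E.n (Fin.succ j.1) + k < E.n i.castSucc := by
  have h1 := E.n_castSucc j.1
  have h2 := E.n_strictAnti.antitone (Fin.castSucc_le_castSucc_iff.mpr j.2)
  have h3 := k.isLt
  omega

/-- The decomposition of `{0, …, n_i - 1}` into the intervals `{n_{j+1}, …, n_j - 1}`. -/
theorem bijective_n_succ_add (i : Fin E.s) :
    Function.Bijective (fun x : Σ j : Set.Ici i, Fin (E.e j) =>
      (⟨E.n (Fin.succ x.1.1) + x.2, E.n_succ_add_lt i x.1 x.2⟩ : Fin (E.n i.castSucc))) := by
  constructor
  · rintro ⟨⟨j, hj⟩, k⟩ ⟨⟨j', hj'⟩, k'⟩ h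
    simp only [Fin.mk.injEq] at h
    have hjj : j = j' := by
      have h1 := E.idx_n_succ_add j k.isLt
      rw [h, E.idx_n_succ_add j' k'.isLt] at h1
      exact (Fin.succ_injective _ h1).symm
    subst hjj
    have hk : k = k' := Fin.ext (by omega)
    rw [hk]
  · intro b
    have hlt : i.castSucc < E.idx b := by
      rw [← not_le, E.idx_le_iff]; omega
    obtain ⟨j, hj⟩ := Fin.exists_succ_eq.mpr ((Fin.zero_le _).trans_lt hlt).ne'
    have hij : i ≤ j := by
      rw [← hj] at hlt
      exact Fin.castSucc_lt_succ_iff.mp hlt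
    have h1 : E.n j.succ ≤ b := hj ▸ E.n_idx_le b
    have h2 : (b : ℕ) < E.n j.castSucc := by
      rw [← not_le, ← E.idx_le_iff, ← hj, not_le]
      exact Fin.castSucc_lt_succ
    have h3 := E.n_castSucc j
    refine ⟨⟨⟨j, hij⟩, ⟨b - E.n j.succ, by simp only; omega⟩⟩, Fin.ext ?_⟩
    simp only
    omega

theorem exists_n_succ_add_eq (i : Fin E.s) {b : ℕ} (hb : b < E.n i.castSucc) :
    ∃ (j : Set.Ici i) (k : Fin (E.e j)), E.n (Fin.succ j.1) + k = b := by
  obtain ⟨⟨j, k⟩, hjk⟩ := (E.bijective_n_succ_add i).2 ⟨b, hb⟩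
  exact ⟨j, k, congrArg Fin.val hjk⟩

theorem sum_range_n {A : Type*} [AddCommMonoid A] (i : Fin E.s) (F : ℕ → A) :
    ∑ b ∈ Finset.range (E.n i.castSucc), F b =
      ∑ j : Set.Ici i, ∑ k : Fin (E.e j), F (E.n (Fin.succ j.1) + k) := by
  rw [Finset.sum_range, ← Fintype.sum_sigma', ← (E.bijective_n_succ_add i).sum_comp]

/-! ### The `R[x]`-basis of the parametrized ideal -/

variable {R : Type*} [CommRing R] (c : E.Param → R)

/-- The coefficient of `y ^ k` in `σ_{j+1,i}`. -/
noncomputable def sigmaCoeff (i : Fin E.s) (j : Set.Ici i) (k : Fin (E.e j)) : R[X] :=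
  ∑ l : Fin (E.d i), C (c (Sum.inr ⟨i, j, l, k⟩)) * X ^ (l : ℕ)

theorem sigma_eq (i : Fin E.s) (j : Set.Ici i) :
    E.sigma c i j = ∑ k, C (E.sigmaCoeff c i j k) * Y ^ (k : ℕ) := by
  rw [sigma, Finset.sum_comm]
  simp only [sigmaCoeff, map_sum, Finset.sum_mul]

theorem _root_.Polynomial.coeff_sum_fin_C_mul_X_pow {n : ℕ} (u : Fin n → R) (l : Fin n) :
    (∑ l : Fin n, C (u l) * X ^ (l : ℕ)).coeff l = u l := by
  simp [finsetSum_coeff, coeff_C_mul, coeff_X_pow, Fin.val_inj]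

theorem _root_.Polynomial.degree_sum_fin_C_mul_X_pow_lt {n : ℕ} (u : Fin n → R) :
    (∑ l : Fin n, C (u l) * X ^ (l : ℕ)).degree < (n : WithBot ℕ) := by
  refine (degree_sum_le _ _).trans_lt ?_
  rw [Finset.sup_lt_iff (WithBot.bot_lt_coe _)]
  intro l _
  refine (degree_C_mul_X_pow_le _ _).trans_lt ?_
  exact_mod_cast l.isLt

theorem isMonicOfDegree_D [Nontrivial R] (i : Fin E.s) : IsMonicOfDegree (E.D c i) (E.d i) := by
  refine ⟨?_, E.D_monic c i⟩
  rw [D, natDegree_sub_eq_left_of_natDegree_lt, natDegree_X_pow]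
  rw [natDegree_X_pow]
  rcases eq_or_ne (E.sigmaDiag c i) 0 with h | h
  · rw [h, natDegree_zero]
    exact E.d_pos i
  · exact (natDegree_lt_iff_degree_lt h).mpr (degree_sum_fin_C_mul_X_pow_lt _)

theorem M_zero : E.M c 0 = 1 := by
  simp [M]

theorem M_succ_eq (i : Fin E.s) : E.M c i.succ = E.D c i * E.M c i.castSucc := by
  simpa using E.M_succ c i i le_rfl

theorem isMonicOfDegree_M [Nontrivial R] (i : Fin (E.s + 1)) :
    IsMonicOfDegree (E.M c i) (E.m i) := by
  induction i using Fin.induction with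
  | zero => rw [M_zero, m_zero]; exact isMonicOfDegree_zero_iff.mpr rfl
  | succ i ih =>
    rw [M_succ_eq, m_succ]
    exact (E.isMonicOfDegree_D c i).mul ih

theorem cofactor_last : E.cofactor c (Fin.last E.s) = 1 := by
  rw [cofactor]; simp

theorem cofactor_castSucc (i : Fin E.s) :
    E.cofactor c i.castSucc = Y ^ E.e i * E.cofactor c i.succ +
      ∑ j : Set.Ici i, E.sigma c i j * C (∏ k ∈ Finset.Ioc i j.1, E.D c k) *
          E.cofactor c (Fin.succ j.1) := by
  rw [cofactor, dif_pos (show ((i.castSucc : Fin _) : ℕ) < E.s from i.isLt)]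
  rfl

/-- Descending induction on the rows of a staircase. -/
theorem reverse_strong_induction {P : Fin (E.s + 1) → Prop} (last : P (Fin.last E.s))
    (step : ∀ i : Fin E.s, (∀ j : Fin E.s, i ≤ j → P j.succ) → P i.castSucc)
    (i : Fin (E.s + 1)) : P i := by
  have main : ∀ k : ℕ, ∀ i : Fin (E.s + 1), E.s - i ≤ k → P i := by
    intro k
    induction k with
    | zero =>
      intro i hi
      rwa [show i = Fin.last E.s from Fin.ext (by have := i.isLt; simp only [Fin.val_last]; omega)]
    | succ k ih =>
      intro i
      refine Fin.lastCases (fun _ => last) (fun i hi => step i fun j hij => ih _ ?_) i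
      rw [Fin.le_def] at hij
      simp only [Fin.val_castSucc, Fin.val_succ] at hi ⊢
      omega
  exact main _ i le_rfl

theorem isMonicOfDegree_cofactor [Nontrivial R] (i : Fin (E.s + 1)) :
    IsMonicOfDegree (E.cofactor c i) (E.n i) := by
  induction i using E.reverse_strong_induction with
  | last => rw [cofactor_last, n_last]; exact isMonicOfDegree_zero_iff.mpr rfl
  | step i ih =>
    have hpos := E.e_pos i
    rw [cofactor_castSucc]
    refine IsMonicOfDegree.add_right ?_ ?_
    · rw [n_castSucc, add_comm]
      exact (isMonicOfDegree_X_pow _ _).mul (ih i le_rfl)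
    · have hn := E.n_castSucc i
      refine (natDegree_sum_le_of_forall_le (n := E.n i.castSucc - 1) _ _ fun j _ => ?_).trans_lt
        (by omega)
      have hj := E.n_castSucc j.1
      have hij := E.n_strictAnti.antitone (Fin.castSucc_le_castSucc_iff.mpr j.2)
      have hpos' := E.e_pos j.1
      -- This bound puts each summand in `y`-degree below `e_{j+1} + n_{j+1} = n_j ≤ n_i`, so it
      -- cannot disturb the leading term.
      have hsig : (E.sigma c i j).natDegree ≤ E.e j.1 - 1 := by
        rw [sigma_eq]
        refine natDegree_sum_le_of_forall_le _ _ fun k _ => ?_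
        refine (natDegree_C_mul_X_pow_le _ _).trans ?_
        have := k.isLt
        omega
      refine natDegree_mul_le.trans ?_
      rw [(ih j.1 j.2).natDegree_eq]
      have := natDegree_mul_le (p := E.sigma c i j) (q := C (∏ k ∈ Finset.Ioc i j.1, E.D c k))
      rw [natDegree_C] at this
      omega

theorem natDegree_basis_le [Nontrivial R] (i : Fin (E.s + 1)) :
    (E.basis c i).natDegree ≤ E.n i :=
  (natDegree_C_mul_le _ _).trans (E.isMonicOfDegree_cofactor c i).natDegree_eq.le

theorem basis_coeff_n [Nontrivial R] (i : Fin (E.s + 1)) :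
    (E.basis c i).coeff (E.n i) = E.M c i := by
  have h := (E.isMonicOfDegree_cofactor c i).monic.coeff_natDegree
  rw [(E.isMonicOfDegree_cofactor c i).natDegree_eq] at h
  rw [basis, coeff_C_mul, h, mul_one]

/-- The element of `y`-degree `b` of the `R[x]`-basis of `⟨h_0, …, h_s⟩`. -/
noncomputable def linBasis (b : ℕ) : R[X][Y] :=
  Y ^ (b - E.n (E.idx b)) * E.basis c (E.idx b)

theorem linBasis_n (i : Fin (E.s + 1)) : E.linBasis c (E.n i) = E.basis c i := by
  simp [linBasis, idx_n]

theorem linBasis_n_succ_add (i : Fin E.s) {k : ℕ} (hk : k < E.e i) :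
    E.linBasis c (E.n i.succ + k) = Y ^ k * E.basis c i.succ := by
  rw [linBasis, E.idx_n_succ_add i hk, Nat.add_sub_cancel_left]

theorem natDegree_linBasis_le [Nontrivial R] (b : ℕ) : (E.linBasis c b).natDegree ≤ b := by
  refine natDegree_mul_le.trans ?_
  have h1 := E.natDegree_basis_le c (E.idx b)
  have h2 := E.n_idx_le b
  have h3 := natDegree_X_pow_le (R := R[X]) (b - E.n (E.idx b))
  omega

theorem linBasis_coeff_self [Nontrivial R] (b : ℕ) :
    (E.linBasis c b).coeff b = E.M c (E.idx b) := by
  rw [linBasis, coeff_X_pow_mul', if_pos (Nat.sub_le _ _), Nat.sub_sub_self (E.n_idx_le b),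
    basis_coeff_n]

theorem isMonicOfDegree_linBasis_coeff [Nontrivial R] (b : ℕ) :
    IsMonicOfDegree ((E.linBasis c b).coeff b) (E.m (E.idx b)) := by
  rw [linBasis_coeff_self]
  exact E.isMonicOfDegree_M c _

theorem linBasis_mem (b : ℕ) : E.linBasis c b ∈ E.paramIdeal c :=
  Ideal.mul_mem_left _ _ (Ideal.subset_span ⟨_, rfl⟩)

theorem sigma_mul_basis (i : Fin E.s) (j : Set.Ici i) (c' : E.Param → R) :
    E.sigma c' i j * E.basis c (Fin.succ j.1) =
      ∑ k : Fin (E.e j), C (E.sigmaCoeff c' i j k) * E.linBasis c (E.n (Fin.succ j.1) + k) := by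
  rw [sigma_eq, Finset.sum_mul]
  refine Finset.sum_congr rfl fun k _ => ?_
  rw [E.linBasis_n_succ_add c j.1 k.isLt, mul_assoc]

theorem D_mul_basis (i : Fin E.s) :
    C (E.D c i) * E.basis c i.castSucc = Y ^ E.e i * E.basis c i.succ +
      ∑ j : Set.Ici i, E.sigma c i j * E.basis c (Fin.succ j.1) := by
  rw [D, C_sub]
  linear_combination E.basis_syzygy c i

/-- Within a step of the staircase, multiplication by `y` passes to the next basis element. At the
top of a step, `b = n_i - 1`, the product is `y ^ e_{i+1} * h_{i+1}`, which the syzygy expresses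
through `h_i` and lower elements. -/
theorem Y_mul_linBasis_mem_span (b : ℕ) :
    Y * E.linBasis c b ∈ Submodule.span R[X] (Set.range (E.linBasis c)) := by
  have hmem : ∀ (p : R[X]) b,
      C p * E.linBasis c b ∈ Submodule.span R[X] (Set.range (E.linBasis c)) := by
    intro p b
    rw [← smul_eq_C_mul]
    exact Submodule.smul_mem _ _ (Submodule.subset_span ⟨b, rfl⟩)
  have hb := E.n_idx_le b
  rcases eq_or_ne (E.idx (b + 1)) (E.idx b) with h | h
  · refine Submodule.subset_span ⟨b + 1, ?_⟩
    rw [linBasis, linBasis, h, ← mul_assoc, ← pow_succ', Nat.sub_add_comm hb]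
  · have hlt : E.idx (b + 1) < E.idx b :=
      lt_of_le_of_ne (E.idx_le_iff.mpr (hb.trans (Nat.le_succ b))) h
    obtain ⟨i, hi⟩ := Fin.exists_succ_eq.mpr ((Fin.zero_le _).trans_lt hlt).ne'
    have h1 : E.n i.castSucc ≤ b + 1 := by
      rw [← E.idx_le_iff]
      rw [← hi] at hlt
      exact Fin.le_castSucc_iff.mpr hlt
    have h2 : b < E.n i.castSucc := by
      rw [← not_le, ← E.idx_le_iff, ← hi, not_le]
      exact Fin.castSucc_lt_succ
    have h3 := E.n_castSucc i
    have : Y * E.linBasis c b = C (E.D c i) * E.linBasis c (E.n i.castSucc) -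
        ∑ j : Set.Ici i, ∑ k : Fin (E.e j),
          C (E.sigmaCoeff c i j k) * E.linBasis c (E.n (Fin.succ j.1) + k) := by
      simp only [← sigma_mul_basis, linBasis_n, D_mul_basis, add_sub_cancel_right]
      rw [linBasis, ← hi, ← mul_assoc, ← pow_succ']
      congr 2
      rw [← hi] at hb
      omega
    rw [this]
    exact Submodule.sub_mem _ (hmem _ _)
      (Submodule.sum_mem _ fun j _ => Submodule.sum_mem _ fun k _ => hmem _ _)

theorem mem_span_linBasis {f : R[X][Y]} (hf : f ∈ E.paramIdeal c) :
    f ∈ Submodule.span R[X] (Set.range (E.linBasis c)) := by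
  have hY : ∀ g ∈ Submodule.span R[X] (Set.range (E.linBasis c)),
      Y * g ∈ Submodule.span R[X] (Set.range (E.linBasis c)) := by
    intro g hg
    induction hg using Submodule.span_induction with
    | mem x hx => obtain ⟨b, rfl⟩ := hx; exact E.Y_mul_linBasis_mem_span c b
    | zero => rw [mul_zero]; exact Submodule.zero_mem _
    | add x y _ _ hx hy => rw [mul_add]; exact Submodule.add_mem _ hx hy
    | smul a x _ hx => rw [mul_smul_comm]; exact Submodule.smul_mem _ _ hx
  have hmul : ∀ p : R[X][Y], ∀ g ∈ Submodule.span R[X] (Set.range (E.linBasis c)),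
      p * g ∈ Submodule.span R[X] (Set.range (E.linBasis c)) := by
    intro p g hg
    induction p using Polynomial.induction_on' with
    | add p q hp hq => rw [add_mul]; exact Submodule.add_mem _ hp hq
    | monomial n a =>
      rw [← C_mul_X_pow_eq_monomial, mul_assoc, ← smul_eq_C_mul]
      refine Submodule.smul_mem _ _ ?_
      induction n with
      | zero => simpa using hg
      | succ n ih => rw [pow_succ', mul_assoc]; exact hY _ ih
  induction hf using Submodule.span_induction with
  | mem x hx =>
    obtain ⟨i, rfl⟩ := hx
    exact Submodule.subset_span ⟨E.n i, E.linBasis_n c i⟩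
  | zero => exact Submodule.zero_mem _
  | add x y _ _ hx hy => exact Submodule.add_mem _ hx hy
  | smul a x _ hx => exact hmul a x hx

/-! ### Normal forms over an arbitrary ring -/

variable {E c}

theorem eq_zero_of_mem_paramIdeal [Nontrivial R] {r : R[X][Y]} (hr : r ∈ E.paramIdeal c)
    (hs : ∀ a b : ℕ, (r.coeff b).coeff a ≠ 0 → (a, b) ∈ E.segment) : r = 0 := by
  rw [forall_mem_segment_iff] at hs
  obtain ⟨q, hq⟩ := Finsupp.mem_span_range_iff_exists_finsupp.mp (E.mem_span_linBasis c hr)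
  have hsub : q.support ⊆ Finset.range (q.support.sup id + 1) := fun b hb =>
    Finset.mem_range.mpr (Nat.lt_succ_of_le (Finset.le_sup (f := id) hb))
  rw [Finsupp.sum_of_support_subset q hsub _ (by simp)] at hq
  simp only [smul_eq_C_mul] at hq
  rw [← hq] at hs ⊢
  have h0 := eq_zero_of_sum_coeff_degree_lt (E.natDegree_linBasis_le c)
    (E.isMonicOfDegree_linBasis_coeff c) _ _ hs
  refine Finset.sum_eq_zero fun b hb => ?_
  rw [h0 b (Finset.mem_range.mp hb), C_0, zero_mul]

theorem IsNormalForm.unique [Nontrivial R] {A r r' : R[X][Y]}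
    (h : E.IsNormalForm (E.paramIdeal c) A r) (h' : E.IsNormalForm (E.paramIdeal c) A r') :
    r = r' := by
  rw [← sub_eq_zero]
  refine eq_zero_of_mem_paramIdeal (c := c) ?_ ?_
  · have := Ideal.sub_mem _ h'.1 h.1
    rwa [sub_sub_sub_cancel_left] at this
  · have h1 := h.2
    have h2 := h'.2
    intro a b hab
    by_contra hn
    refine hab ?_
    rw [coeff_sub, coeff_sub, not_imp_comm.mp (h1 a b) hn, not_imp_comm.mp (h2 a b) hn, sub_zero]

variable (E c)

theorem exists_isNormalForm [Nontrivial R] (A : R[X][Y]) :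
    ∃ r, E.IsNormalForm (E.paramIdeal c) A r := by
  obtain ⟨q, hq⟩ := exists_sub_sum_coeff_degree_lt (E.natDegree_linBasis_le c)
    (E.isMonicOfDegree_linBasis_coeff c) (A.natDegree + 1) A
    (degree_le_natDegree.trans_lt (by exact_mod_cast Nat.lt_succ_self _))
  refine ⟨_, ?_, E.forall_mem_segment_iff.mpr hq⟩
  rw [sub_sub_cancel]
  exact Ideal.sum_mem _ fun b _ => Ideal.mul_mem_left _ _ (E.linBasis_mem c b)

variable {E c}

/-- The remainder of the division lies in the ideal and is reduced, hence zero. Unlike mere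
membership in the span, this bounds the `y`-degrees of the basis elements used. -/
theorem exists_eq_sum_linBasis [Nontrivial R] {f : R[X][Y]} (hf : f ∈ E.paramIdeal c) {n : ℕ}
    (hn : f.degree < n) : ∃ q : ℕ → R[X], f = ∑ b ∈ Finset.range n, C (q b) * E.linBasis c b := by
  obtain ⟨q, hq⟩ := exists_sub_sum_coeff_degree_lt (E.natDegree_linBasis_le c)
    (E.isMonicOfDegree_linBasis_coeff c) n f hn
  refine ⟨q, sub_eq_zero.mp (eq_zero_of_mem_paramIdeal (c := c) ?_
    (E.forall_mem_segment_iff.mpr hq))⟩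
  exact Ideal.sub_mem _ hf (Ideal.sum_mem _ fun b _ => Ideal.mul_mem_left _ _ (E.linBasis_mem c b))

theorem eq_zero_of_sum_linBasis_eq_zero [Nontrivial R] {n : ℕ} {q : ℕ → R[X]}
    (h : ∑ b ∈ Finset.range n, C (q b) * E.linBasis c b = 0) : ∀ b < n, q b = 0 :=
  eq_zero_of_sum_coeff_degree_lt (E.natDegree_linBasis_le c) (E.isMonicOfDegree_linBasis_coeff c)
    n q fun b => by simp [h]

end Staircase

/-! ### The ideal determines its parameters -/

namespace Staircase

variable {E : Staircase} {R : Type*} [CommRing R] {c c' : E.Param → R}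

/-- Expand `h_i` in the other basis and compare coefficients of `y ^ n_i`: only the basis element of
degree `n_i` contributes. -/
theorem M_dvd_M [Nontrivial R] (h : E.paramIdeal c ≤ E.paramIdeal c') (i : Fin (E.s + 1)) :
    E.M c' i ∣ E.M c i := by
  have hdeg : (E.basis c i).degree < (E.n i + 1 : ℕ) :=
    (degree_le_of_natDegree_le (E.natDegree_basis_le c i)).trans_lt
      (by exact_mod_cast Nat.lt_succ_self _)
  obtain ⟨q, hq⟩ := exists_eq_sum_linBasis (h (Ideal.subset_span ⟨i, rfl⟩)) hdeg
  refine ⟨q (E.n i), ?_⟩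
  have h1 := congrArg (fun p => p.coeff (E.n i)) hq
  simp only [basis_coeff_n, finsetSum_coeff, coeff_C_mul] at h1
  rw [Finset.sum_range_succ, linBasis_n, basis_coeff_n] at h1
  rw [h1, Finset.sum_eq_zero, zero_add, mul_comm]
  intro b hb
  rw [coeff_eq_zero_of_natDegree_lt
    ((E.natDegree_linBasis_le c' b).trans_lt (Finset.mem_range.mp hb)), mul_zero]

theorem M_eq_M [Nontrivial R] (h : E.paramIdeal c = E.paramIdeal c') (i : Fin (E.s + 1)) :
    E.M c i = E.M c' i := by
  have h1 := E.isMonicOfDegree_M c i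
  have h2 := E.isMonicOfDegree_M c' i
  exact (eq_of_monic_of_dvd_of_natDegree_le h1.monic h2.monic (M_dvd_M h.ge i)
    (by rw [h1.natDegree_eq, h2.natDegree_eq])).symm

theorem D_eq_D [Nontrivial R] (h : E.paramIdeal c = E.paramIdeal c') (i : Fin E.s) :
    E.D c i = E.D c' i := by
  have h1 := M_eq_M h i.succ
  rw [M_succ_eq, M_succ_eq, M_eq_M h i.castSucc] at h1
  exact (E.isMonicOfDegree_M c' _).monic.isRegular.right h1

theorem sigmaDiag_coeff (c : E.Param → R) (i : Fin E.s) (l : Fin (E.d i)) :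
    (E.sigmaDiag c i).coeff l = c (Sum.inl ⟨i, l⟩) :=
  coeff_sum_fin_C_mul_X_pow _ _

theorem sigmaCoeff_coeff (c : E.Param → R) (i : Fin E.s) (j : Set.Ici i) (k : Fin (E.e j))
    (l : Fin (E.d i)) : (E.sigmaCoeff c i j k).coeff l = c (Sum.inr ⟨i, j, l, k⟩) :=
  coeff_sum_fin_C_mul_X_pow (fun l => c (Sum.inr ⟨i, j, l, k⟩)) l

theorem exists_eq_n_succ_add (E : Staircase) {A : Type*} [Zero A] (i : Fin E.s)
    (F : ∀ j : Set.Ici i, Fin (E.e j) → A) :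
    ∃ S : ℕ → A, ∀ (j : Set.Ici i) (k : Fin (E.e j)), S (E.n (Fin.succ j.1) + k) = F j k := by
  obtain ⟨inv, hinv, -⟩ := Function.bijective_iff_has_inverse.mp (E.bijective_n_succ_add i)
  refine ⟨fun b => if hb : b < E.n i.castSucc then F _ (inv ⟨b, hb⟩).2 else 0, fun j k => ?_⟩
  have h := hinv ⟨j, k⟩
  simp only at h ⊢
  rw [dif_pos (E.n_succ_add_lt i j k), h]

/-- The difference of the two `h_i` has `y`-degree below `n_i`, so it is a combination of lower
basis elements with coefficients `q b`. Multiplied by `D_{i+1}`, it becomes the difference of the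
two right-hand sides of the syzygies, whose coefficients have `x`-degree below `d_{i+1}`. Freeness
and monicity of `D_{i+1}` force both to vanish. -/
theorem sigmaCoeff_eq_and_basis_eq [Nontrivial R] (h : E.paramIdeal c = E.paramIdeal c')
    (i : Fin E.s) (hb : ∀ j, i ≤ j → E.basis c j.succ = E.basis c' j.succ) :
    (∀ j k, E.sigmaCoeff c i j k = E.sigmaCoeff c' i j k) ∧
      E.basis c i.castSucc = E.basis c' i.castSucc := by
  have hD := E.isMonicOfDegree_D c i
  have hdeg : (E.basis c i.castSucc - E.basis c' i.castSucc).degree < E.n i.castSucc := by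
    rw [degree_lt_iff_coeff_zero]
    intro k hk
    rcases hk.eq_or_lt with rfl | hk
    · rw [coeff_sub, basis_coeff_n, basis_coeff_n, M_eq_M h, sub_self]
    · rw [coeff_sub,
        coeff_eq_zero_of_natDegree_lt ((E.natDegree_basis_le c i.castSucc).trans_lt hk),
        coeff_eq_zero_of_natDegree_lt ((E.natDegree_basis_le c' i.castSucc).trans_lt hk), sub_self]
  have hmem : E.basis c i.castSucc - E.basis c' i.castSucc ∈ E.paramIdeal c :=
    Ideal.sub_mem _ (Ideal.subset_span ⟨_, rfl⟩) (by rw [h]; exact Ideal.subset_span ⟨_, rfl⟩)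
  obtain ⟨q, hq⟩ := exists_eq_sum_linBasis hmem hdeg
  obtain ⟨S, hS⟩ : ∃ S : ℕ → R[X], ∀ (j : Set.Ici i) (k : Fin (E.e j)),
      S (E.n (Fin.succ j.1) + k) = E.sigmaCoeff c i j k - E.sigmaCoeff c' i j k :=
    E.exists_eq_n_succ_add i _
  have hsum : ∑ b ∈ Finset.range (E.n i.castSucc), C (E.D c i * q b - S b) * E.linBasis c b = 0 := by
    simp only [C_sub, C_mul, sub_mul, Finset.sum_sub_distrib, mul_assoc, ← Finset.mul_sum]
    rw [← hq, E.sum_range_n i (fun b => C (S b) * E.linBasis c b), mul_sub, D_mul_basis]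
    simp only [hS, C_sub, sub_mul, Finset.sum_sub_distrib, ← sigma_mul_basis]
    rw [D_eq_D h, D_mul_basis, hb i le_rfl,
      Finset.sum_congr rfl fun (j : Set.Ici i) _ =>
        congrArg (fun p => E.sigma c' i j * p) (hb j.1 j.2)]
    ring
  have hz := eq_zero_of_sum_linBasis_eq_zero hsum
  have hboth : ∀ b < E.n i.castSucc, q b = 0 ∧ S b = 0 := by
    intro b hb
    have hSdeg : (S b).degree < (E.d i : WithBot ℕ) := by
      obtain ⟨j, k, rfl⟩ := E.exists_n_succ_add_eq i hb
      rw [hS]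
      exact (degree_sub_le _ _).trans_lt (max_lt (degree_sum_fin_C_mul_X_pow_lt _)
        (degree_sum_fin_C_mul_X_pow_lt _))
    have h0 := sub_eq_zero.mp (hz b hb)
    have hq0 : q b = 0 := by
      by_contra hne
      rw [← h0, mul_comm, hD.monic.degree_mul, degree_eq_natDegree hne,
        degree_eq_natDegree hD.ne_zero, hD.natDegree_eq] at hSdeg
      norm_cast at hSdeg
      omega
    exact ⟨hq0, by rw [← h0, hq0, mul_zero]⟩
  constructor
  · intro j k
    rw [← sub_eq_zero, ← hS]
    exact (hboth _ (E.n_succ_add_lt i j k)).2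
  · rw [← sub_eq_zero, hq]
    refine Finset.sum_eq_zero fun b hb => ?_
    rw [(hboth b (Finset.mem_range.mp hb)).1, C_0, zero_mul]

/-- The parameters are determined by the ideal. -/
theorem paramIdeal_injective [Nontrivial R] :
    Function.Injective (E.paramIdeal : (E.Param → R) → Ideal R[X][Y]) := by
  intro c c' h
  have hb : ∀ i, E.basis c i = E.basis c' i := by
    intro i
    induction i using E.reverse_strong_induction with
    | last => rw [basis, basis, cofactor_last, cofactor_last, M_eq_M h]
    | step i ih => exact (sigmaCoeff_eq_and_basis_eq h i ih).2
  funext p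
  rcases p with ⟨i, l⟩ | ⟨i, j, l, k⟩
  · rw [← sigmaDiag_coeff c, ← sigmaDiag_coeff c']
    have := D_eq_D h i
    rw [D, D, sub_right_inj] at this
    rw [this]
  · rw [← sigmaCoeff_coeff c, ← sigmaCoeff_coeff c',
      (sigmaCoeff_eq_and_basis_eq h i fun j _ => hb _).1]

end Staircase

/-! ### Every ideal of the cell has parameters -/

namespace Staircase

section Congruence

variable {E : Staircase} {R : Type*} [CommRing R] {c c' : E.Param → R}

theorem M_congr (hD : ∀ i, E.D c i = E.D c' i) (i : Fin (E.s + 1)) : E.M c i = E.M c' i := by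
  simp only [M, hD]

/-- `h_i` depends only on the rows of the parameters from the `i`-th onwards. -/
theorem basis_congr (hD : ∀ i, E.D c i = E.D c' i) (i : Fin (E.s + 1))
    (hc : ∀ j : Fin E.s, i ≤ j.castSucc → ∀ x, c (Sum.inr ⟨j, x⟩) = c' (Sum.inr ⟨j, x⟩)) :
    E.basis c i = E.basis c' i := by
  rw [basis, basis, M_congr hD]
  congr 1
  induction i using E.reverse_strong_induction with
  | last => rw [cofactor_last, cofactor_last]
  | step i ih =>
    have ih' : ∀ j : Fin E.s, i ≤ j → E.cofactor c j.succ = E.cofactor c' j.succ := fun j hij =>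
      ih j hij fun k hk x => hc k (((Fin.castSucc_le_castSucc_iff.mpr hij).trans
        Fin.castSucc_lt_succ.le).trans hk) x
    have hsig : ∀ j, E.sigma c i j = E.sigma c' i j := fun j => by
      simp only [sigma, hc i le_rfl]
    rw [cofactor_castSucc, cofactor_castSucc, ih' i le_rfl,
      Finset.sum_congr rfl fun (j : Set.Ici i) _ => by rw [hsig, ih' j.1 j.2]]
    simp only [hD]

end Congruence

variable {E : Staircase} {K : Type*} [Field K] {I : Ideal K[X][Y]}

theorem exists_le_of_mem_monomialIdeal {p : K[X][Y]} (hp : p ∈ E.monomialIdeal K) {a b : ℕ}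
    (hab : (p.coeff b).coeff a ≠ 0) : ∃ i, E.m i ≤ a ∧ E.n i ≤ b := by
  obtain ⟨q, rfl⟩ := Ideal.mem_span_range_iff_exists_fun.mp hp
  rw [finsetSum_coeff, finsetSum_coeff] at hab
  obtain ⟨i, -, hi⟩ := Finset.exists_ne_zero_of_sum_ne_zero hab
  refine ⟨i, ?_⟩
  rw [← mul_assoc, coeff_mul_X_pow'] at hi
  split_ifs at hi with hb
  · rw [coeff_mul_C, coeff_mul_X_pow'] at hi
    split_ifs at hi with ha
    · exact ⟨ha, hb⟩
    · exact absurd rfl hi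
  · simp at hi

/-- The initial monomial of an element of an ideal in the cell. -/
theorem exists_le_of_mem (hI : I ∈ E.cell K) {p : K[X][Y]} (hp : p ∈ I) (h0 : p ≠ 0) :
    ∃ i, E.m i ≤ p.leadingCoeff.natDegree ∧ E.n i ≤ p.natDegree := by
  have hI : initialIdeal I = E.monomialIdeal K := hI
  have hmem : C (X ^ p.leadingCoeff.natDegree) * Y ^ p.natDegree ∈ E.monomialIdeal K := by
    rw [← hI]
    exact Ideal.subset_span ⟨p, hp, h0, rfl⟩
  refine exists_le_of_mem_monomialIdeal hmem ?_
  rw [coeff_C_mul, coeff_X_pow_self, mul_one, coeff_X_pow_self]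
  exact one_ne_zero

theorem eq_zero_of_mem_cell (hI : I ∈ E.cell K) {r : K[X][Y]} (hr : r ∈ I)
    (hs : ∀ a b : ℕ, (r.coeff b).coeff a ≠ 0 → (a, b) ∈ E.segment) : r = 0 := by
  by_contra h0
  obtain ⟨i, hi⟩ := exists_le_of_mem hI hr h0
  refine hs r.leadingCoeff.natDegree r.natDegree ?_ i hi
  rw [coeff_natDegree, coeff_natDegree]
  simpa using h0

/-- Every corner monomial is a multiple of the initial monomial of an element of the ideal. -/
theorem exists_mem_le (hI : I ∈ E.cell K) (i : Fin (E.s + 1)) :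
    ∃ p ∈ I, p ≠ 0 ∧ p.leadingCoeff.natDegree ≤ E.m i ∧ p.natDegree ≤ E.n i := by
  have hI : initialIdeal I = E.monomialIdeal K := hI
  have hmem : C (X ^ E.m i) * Y ^ E.n i ∈ initialIdeal I := by
    rw [hI]
    exact Ideal.subset_span ⟨i, rfl⟩
  have hne : ((C (X ^ E.m i) * Y ^ E.n i : K[X][Y]).coeff (E.n i)).coeff (E.m i) ≠ 0 := by
    rw [coeff_C_mul, coeff_X_pow_self, mul_one, coeff_X_pow_self]
    exact one_ne_zero
  generalize (C (X ^ E.m i) * Y ^ E.n i : K[X][Y]) = g at hmem hne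
  -- Quantifying over all monomials of all elements of the initial ideal makes the claim stable
  -- under sums and multiples.
  have key : ∀ g ∈ initialIdeal I, ∀ a b, (g.coeff b).coeff a ≠ 0 →
      ∃ p ∈ I, p ≠ 0 ∧ p.leadingCoeff.natDegree ≤ a ∧ p.natDegree ≤ b := by
    intro g hg
    induction hg using Submodule.span_induction with
    | mem q hq =>
      obtain ⟨p, hp, h0, rfl⟩ := hq
      intro a b hab
      refine ⟨p, hp, h0, ?_⟩
      rw [coeff_C_mul, coeff_X_pow] at hab
      split_ifs at hab with hb
      · rw [mul_one, coeff_X_pow] at hab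
        split_ifs at hab with ha
        · exact ⟨ha.ge, hb.ge⟩
        · exact absurd rfl hab
      · simp at hab
    | zero => intro a b hab; simp at hab
    | add x y _ _ hx hy =>
      intro a b hab
      rw [coeff_add, coeff_add] at hab
      by_cases h : (x.coeff b).coeff a = 0
      · exact hy a b fun h' => hab (by rw [h, h', add_zero])
      · exact hx a b h
    | smul u x _ hx =>
      intro a b hab
      rw [smul_eq_mul, coeff_mul, finsetSum_coeff] at hab
      obtain ⟨⟨b1, b2⟩, hb, h1⟩ := Finset.exists_ne_zero_of_sum_ne_zero hab
      rw [coeff_mul] at h1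
      obtain ⟨⟨a1, a2⟩, ha, h2⟩ := Finset.exists_ne_zero_of_sum_ne_zero h1
      rw [Finset.HasAntidiagonal.mem_antidiagonal] at ha hb
      obtain ⟨p, hp, h0, h3, h4⟩ := hx a2 b2 (right_ne_zero_of_mul h2)
      simp only at ha hb
      exact ⟨p, hp, h0, by omega, by omega⟩
  exact key g hmem _ _ hne

/-- The corner dividing the initial monomial has height at most `n_i`, so its index is at least `i`.
-/
theorem m_le_natDegree (hI : I ∈ E.cell K) (i : Fin (E.s + 1)) {p : K[X]}
    (hp : p ∈ I.leadingCoeffNth (E.n i)) (h0 : p ≠ 0) : E.m i ≤ p.natDegree := by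
  obtain ⟨f, hf, hdeg, rfl⟩ := (Ideal.mem_leadingCoeffNth _ _ _).mp hp
  obtain ⟨j, hj1, hj2⟩ := exists_le_of_mem hI hf (by simpa using h0)
  have : E.n j ≤ E.n i := hj2.trans (natDegree_le_of_degree_le hdeg)
  exact (E.m_strictMono.monotone (E.n_strictAnti.le_iff_ge.mp this)).trans hj1

/-- The degree bound `m_i` is attained, by the element below the `i`-th corner monomial; a monic
polynomial of least degree generates. -/
theorem exists_isMonicOfDegree_leadingCoeffNth (hI : I ∈ E.cell K) (i : Fin (E.s + 1)) :
    ∃ g ∈ I.leadingCoeffNth (E.n i), IsMonicOfDegree g (E.m i) ∧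
      ∀ p ∈ I.leadingCoeffNth (E.n i), g ∣ p := by
  obtain ⟨f, hf, h0, h1, h2⟩ := exists_mem_le hI i
  have hf' : f.leadingCoeff ∈ I.leadingCoeffNth (E.n i) :=
    (Ideal.mem_leadingCoeffNth _ _ _).mpr ⟨f, hf, degree_le_of_natDegree_le h2, rfl⟩
  have h0' : f.leadingCoeff ≠ 0 := by simpa using h0
  have hdeg := le_antisymm h1 (m_le_natDegree hI i hf' h0')
  have hmon : IsMonicOfDegree (f.leadingCoeff * C f.leadingCoeff.leadingCoeff⁻¹) (E.m i) :=
    ⟨by rw [natDegree_mul_leadingCoeff_inv _ h0', hdeg], monic_mul_leadingCoeff_inv h0'⟩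
  have hmem := Ideal.mul_mem_right (C f.leadingCoeff.leadingCoeff⁻¹) _ hf'
  generalize f.leadingCoeff * C f.leadingCoeff.leadingCoeff⁻¹ = g at hmon hmem
  refine ⟨g, hmem, hmon, fun p hp => ?_⟩
  rw [← modByMonic_eq_zero_iff_dvd hmon.monic]
  by_contra hne
  have hr : p %ₘ g ∈ I.leadingCoeffNth (E.n i) := by
    rw [modByMonic_eq_sub_mul_div]
    exact Ideal.sub_mem _ hp (Ideal.mul_mem_right _ _ hmem)
  have h3 := m_le_natDegree hI i hr hne
  have h4 := degree_modByMonic_lt p hmon.monic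
  rw [degree_eq_natDegree hne, degree_eq_natDegree hmon.ne_zero, hmon.natDegree_eq] at h4
  norm_cast at h4
  omega

/-- The leading coefficients of an ideal in the cell determine diagonal parameters. -/
theorem exists_M_mem_leadingCoeffNth (hI : I ∈ E.cell K) :
    ∃ c : E.Param → K, ∀ i, E.M c i ∈ I.leadingCoeffNth (E.n i) := by
  choose g hg hmon hdvd using exists_isMonicOfDegree_leadingCoeffNth hI
  -- The leading coefficient ideals grow with the `y`-degree, so their generators divide one
  -- another; the quotients become the `D_{i+1}`.
  have hq : ∀ i : Fin E.s, ∃ q, g i.succ = g i.castSucc * q := fun i =>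
    hdvd _ _ (I.leadingCoeffNth_mono (E.n_strictAnti Fin.castSucc_lt_succ).le (hg _))
  choose q hq using hq
  have hqm : ∀ i, IsMonicOfDegree (q i) (E.d i) := by
    intro i
    refine (hmon i.castSucc).of_mul_left ?_
    rw [← hq, add_comm, ← E.m_succ]
    exact hmon _
  -- The sign comes from `D = x ^ d - σ`; the off-diagonal zeros are placeholders, replaced row by
  -- row later.
  refine ⟨Sum.elim (fun x => -(q x.1).coeff x.2) 0, fun i => ?_⟩
  have hD : ∀ i, E.D (Sum.elim (fun x => -(q x.1).coeff x.2) 0) i = q i := by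
    intro i
    simp only [D, sigmaDiag, Sum.elim_inl, C_neg, neg_mul, Finset.sum_neg_distrib, sub_neg_eq_add]
    rw [← Finset.sum_range fun l => C ((q i).coeff l) * X ^ l]
    have := (hqm i).monic.as_sum
    rw [(hqm i).natDegree_eq] at this
    exact this.symm
  convert hg i
  induction i using Fin.induction with
  | zero =>
    have := hmon 0
    rw [E.m_zero, isMonicOfDegree_zero_iff] at this
    rw [M_zero, this]
  | succ i ih => rw [M_succ_eq, hD, ih, hq, mul_comm]

/-- Below `y`-degree `n_i` only multiples of `h_{i+1}, …, h_s` occur in the division, so it suffices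
that these lie in `I`. -/
theorem exists_eq_sum_linBasis_of_mem (hI : I ∈ E.cell K) {c : E.Param → K} (i : Fin E.s)
    (hc : ∀ j, i ≤ j → E.basis c j.succ ∈ I) {f : K[X][Y]} (hf : f ∈ I)
    (hdeg : f.degree < E.n i.castSucc) :
    ∃ q : ℕ → K[X], f = ∑ b ∈ Finset.range (E.n i.castSucc), C (q b) * E.linBasis c b := by
  obtain ⟨q, hq⟩ := exists_sub_sum_coeff_degree_lt (E.natDegree_linBasis_le c)
    (E.isMonicOfDegree_linBasis_coeff c) _ f hdeg
  refine ⟨q, sub_eq_zero.mp (eq_zero_of_mem_cell hI ?_ (E.forall_mem_segment_iff.mpr hq))⟩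
  refine Ideal.sub_mem _ hf (Ideal.sum_mem _ fun b hb => Ideal.mul_mem_left _ _ ?_)
  obtain ⟨j, k, rfl⟩ := E.exists_n_succ_add_eq i (Finset.mem_range.mp hb)
  rw [E.linBasis_n_succ_add c j.1 k.isLt]
  exact Ideal.mul_mem_left _ _ (hc j.1 j.2)

/-- The parameters of the `i`-th row can be chosen such that `h_i` lies in the ideal. -/
theorem exists_basis_castSucc_mem (hI : I ∈ E.cell K) {c : E.Param → K} (i : Fin E.s)
    (hM : E.M c i.castSucc ∈ I.leadingCoeffNth (E.n i.castSucc))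
    (hc : ∀ j, i ≤ j → E.basis c j.succ ∈ I) :
    ∃ c' : E.Param → K, (∀ k, E.D c' k = E.D c k) ∧
      (∀ j, i ≤ j → E.basis c' j.succ ∈ I) ∧ E.basis c' i.castSucc ∈ I := by
  classical
  obtain ⟨p, hp, hpdeg, hpM⟩ := (Ideal.mem_leadingCoeffNth _ _ _).mp hM
  have hpdeg := natDegree_le_of_degree_le hpdeg
  set H := Y ^ (E.n i.castSucc - p.natDegree) * p with hH
  have hHmem : H ∈ I := Ideal.mul_mem_left _ _ hp
  have hHdeg : H.natDegree ≤ E.n i.castSucc := by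
    refine natDegree_mul_le.trans ?_
    have := natDegree_X_pow_le (R := K[X]) (E.n i.castSucc - p.natDegree)
    omega
  have hHcoeff : H.coeff (E.n i.castSucc) = E.M c i.castSucc := by
    rw [hH, coeff_X_pow_mul', if_pos (Nat.sub_le _ _), Nat.sub_sub_self hpdeg, ← hpM,
      coeff_natDegree]
  have hn := E.n_castSucc i
  -- The coefficients of `y ^ n_i` cancel, because `D_{i+1} M_i = M_{i+1}`.
  have hmem : C (E.D c i) * H - Y ^ E.e i * E.basis c i.succ ∈ I :=
    Ideal.sub_mem _ (Ideal.mul_mem_left _ _ hHmem) (Ideal.mul_mem_left _ _ (hc i le_rfl))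
  have hdeg : (C (E.D c i) * H - Y ^ E.e i * E.basis c i.succ).degree <
      (E.n i.castSucc : WithBot ℕ) := by
    rw [degree_lt_iff_coeff_zero]
    intro k hk
    rw [coeff_sub, coeff_C_mul, coeff_X_pow_mul' (E.basis c i.succ), if_pos (by omega)]
    rcases hk.eq_or_lt with rfl | hk
    · rw [hHcoeff, show E.n i.castSucc - E.e i = E.n i.succ by omega, basis_coeff_n, M_succ_eq,
        sub_self]
    · rw [coeff_eq_zero_of_natDegree_lt (hHdeg.trans_lt hk), coeff_eq_zero_of_natDegree_lt
        ((E.natDegree_basis_le c i.succ).trans_lt (by omega)), mul_zero, sub_self]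
  obtain ⟨τ, hτ⟩ := exists_eq_sum_linBasis_of_mem hI i hc hmem hdeg
  -- The new row consists of the remainders of the `τ b` modulo `D_{i+1}`; the quotients are
  -- absorbed by correcting `H` (see `hkey`).
  let c' : E.Param → K := Sum.elim (fun x => c (Sum.inl x)) fun x =>
    if x.1 = i then (τ (E.n (Fin.succ x.2.1.1) + x.2.2.2) %ₘ E.D c i).coeff x.2.2.1
      else c (Sum.inr x)
  have hD' : ∀ k, E.D c' k = E.D c k := fun k => rfl
  have hb' : ∀ j, i ≤ j → E.basis c' j.succ = E.basis c j.succ := by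
    intro j hij
    refine basis_congr hD' _ fun k hk x => ?_
    have : k ≠ i := by
      rintro rfl
      exact (Fin.castSucc_lt_succ.trans_le ((Fin.succ_le_succ_iff.mpr hij).trans hk)).false
    simp only [c', Sum.elim_inr, if_neg this]
  have hsig : ∀ (j : Set.Ici i) (k : Fin (E.e j)),
      E.sigmaCoeff c' i j k = τ (E.n (Fin.succ j.1) + k) %ₘ E.D c i := by
    intro j k
    have hmon := E.isMonicOfDegree_D c i
    have hlt := natDegree_modByMonic_lt (τ (E.n (Fin.succ j.1) + k)) hmon.monic fun h => by
      have := hmon.natDegree_eq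
      rw [h, natDegree_one] at this
      exact (E.d_pos i).ne this
    rw [hmon.natDegree_eq] at hlt
    simp only [sigmaCoeff, c', Sum.elim_inr, if_true]
    rw [← Finset.sum_range fun l => C ((τ (E.n (Fin.succ j.1) + k) %ₘ E.D c i).coeff l) * X ^ l]
    exact (as_sum_range_C_mul_X_pow' _ hlt).symm
  refine ⟨c', hD', fun j hij => hb' j hij ▸ hc j hij, ?_⟩
  have hkey : E.basis c' i.castSucc = H -
      ∑ b ∈ Finset.range (E.n i.castSucc), C (τ b /ₘ E.D c i) * E.linBasis c b := by
    have h1 := E.D_mul_basis c' i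
    have h2 : ∑ j : Set.Ici i, E.sigma c' i j * E.basis c' (Fin.succ j.1) =
        ∑ b ∈ Finset.range (E.n i.castSucc), C (τ b %ₘ E.D c i) * E.linBasis c b := by
      rw [E.sum_range_n i fun b => C (τ b %ₘ E.D c i) * E.linBasis c b]
      refine Finset.sum_congr rfl fun j _ => ?_
      rw [hb' j.1 j.2, sigma_mul_basis]
      simp only [hsig]
    have h3 : ∑ b ∈ Finset.range (E.n i.castSucc), C (τ b) * E.linBasis c b =
        ∑ b ∈ Finset.range (E.n i.castSucc), C (τ b %ₘ E.D c i) * E.linBasis c b +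
          C (E.D c i) *
            ∑ b ∈ Finset.range (E.n i.castSucc), C (τ b /ₘ E.D c i) * E.linBasis c b := by
      rw [Finset.mul_sum, ← Finset.sum_add_distrib]
      refine Finset.sum_congr rfl fun b _ => ?_
      conv_lhs => rw [← modByMonic_add_div (τ b) (E.D c i), C_add, C_mul]
      ring
    rw [h2, hD', hb' i le_rfl] at h1
    have hne : (C (E.D c i) : K[X][Y]) ≠ 0 := C_ne_zero.mpr (E.D_monic c i).ne_zero
    refine mul_left_cancel₀ hne ?_
    rw [mul_sub]
    linear_combination h1 - h3 - hτ
  rw [hkey]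
  refine Ideal.sub_mem _ hHmem (Ideal.sum_mem _ fun b hb => Ideal.mul_mem_left _ _ ?_)
  obtain ⟨j, k, rfl⟩ := E.exists_n_succ_add_eq i (Finset.mem_range.mp hb)
  rw [E.linBasis_n_succ_add c j.1 k.isLt]
  exact Ideal.mul_mem_left _ _ (hc j.1 j.2)

/-- Every ideal in the Gröbner cell has Gröbner parameters. -/
theorem exists_paramIdeal_eq (hI : I ∈ E.cell K) : ∃ c : E.Param → K, E.paramIdeal c = I := by
  obtain ⟨c₀, hc₀⟩ := exists_M_mem_leadingCoeffNth hI
  have main : ∀ i : Fin (E.s + 1), ∃ c : E.Param → K, (∀ k, E.D c k = E.D c₀ k) ∧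
      ∀ j, i ≤ j → E.basis c j ∈ I := by
    intro i
    induction i using Fin.reverseInduction with
    | last =>
      refine ⟨c₀, fun _ => rfl, fun j hj => ?_⟩
      obtain rfl := Fin.last_le_iff.mp hj
      rw [basis, cofactor_last, mul_one, ← Ideal.mem_leadingCoeffNth_zero, ← E.n_last]
      exact hc₀ _
    | cast i ih =>
      obtain ⟨c, hD, hc⟩ := ih
      obtain ⟨c', hD', h1, h2⟩ := exists_basis_castSucc_mem hI i (c := c)
        (by rw [M_congr hD]; exact hc₀ _)
        (fun j hij => hc _ (Fin.succ_le_succ_iff.mpr hij))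
      refine ⟨c', fun k => (hD' k).trans (hD k), fun j hj => ?_⟩
      rcases hj.eq_or_lt with rfl | hj
      · exact h2
      · obtain ⟨j, rfl⟩ := Fin.exists_succ_eq.mpr ((Fin.zero_le _).trans_lt hj).ne'
        exact h1 j (Fin.castSucc_lt_succ_iff.mp hj)
  obtain ⟨c, -, hc⟩ := main 0
  have hle : E.paramIdeal c ≤ I :=
    Ideal.span_le.mpr (by rintro _ ⟨j, rfl⟩; exact hc j (Fin.zero_le _))
  refine ⟨c, le_antisymm hle fun f hf => ?_⟩
  -- The normal form of `f ∈ I` lies in `I` and is supported on the segment, hence vanishes.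
  obtain ⟨r, hr, hs⟩ := E.exists_isNormalForm c f
  have h0 : r = 0 := by
    refine eq_zero_of_mem_cell hI ?_ hs
    have := Ideal.sub_mem _ hf (hle hr)
    rwa [sub_sub_cancel] at this
  rwa [h0, sub_zero] at hr

end Staircase

/-! ### Base change and infinitesimal rigidity -/

namespace Staircase

variable {E : Staircase} {R S : Type*} [CommRing R] [CommRing S]

theorem sigmaDiag_map (φ : R →+* S) (c : E.Param → R) (i : Fin E.s) :
    (E.sigmaDiag c i).map φ = E.sigmaDiag (φ ∘ c) i := by
  simp [sigmaDiag, Polynomial.map_sum]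

theorem sigma_map (φ : R →+* S) (c : E.Param → R) (i : Fin E.s) (j : Set.Ici i) :
    (E.sigma c i j).map (mapRingHom φ) = E.sigma (φ ∘ c) i j := by
  simp [sigma, Polynomial.map_sum]

theorem D_map (φ : R →+* S) (c : E.Param → R) (i : Fin E.s) :
    (E.D c i).map φ = E.D (φ ∘ c) i := by
  simp [D, sigmaDiag_map]

/-- The images satisfy the relations that characterize the basis, so the recursion need not be
unfolded. -/
theorem basis_map (φ : R →+* S) (c : E.Param → R) (i : Fin (E.s + 1)) :
    (E.basis c i).map (mapRingHom φ) = E.basis (φ ∘ c) i := by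
  refine congrFun (E.eq_basis (φ ∘ c) (fun i => (E.basis c i).map (mapRingHom φ)) ?_ ?_) i
  · simp [basis_last, D_map, Polynomial.map_prod]
  · intro i
    have h := congrArg (Polynomial.map (mapRingHom φ)) (E.basis_syzygy c i)
    simpa only [Polynomial.map_sub, Polynomial.map_add, Polynomial.map_mul, Polynomial.map_pow,
      Polynomial.map_sum, map_C, map_X, coe_mapRingHom, sigmaDiag_map, sigma_map] using h

theorem paramIdeal_map (φ : R →+* S) (c : E.Param → R) :
    (E.paramIdeal c).map (mapRingHom (mapRingHom φ)) = E.paramIdeal (φ ∘ c) := by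
  rw [paramIdeal, paramIdeal, Ideal.map_span, ← Set.range_comp]
  congr 2
  funext i
  exact basis_map φ c i

theorem map_mem_paramIdeal (φ : R →+* S) {c : E.Param → R} {f : R[X][Y]}
    (hf : f ∈ E.paramIdeal c) : f.map (mapRingHom φ) ∈ E.paramIdeal (φ ∘ c) := by
  rw [← paramIdeal_map]
  exact Ideal.mem_map_of_mem (mapRingHom (mapRingHom φ)) hf

theorem IsNormalForm.map (φ : R →+* S) {c : E.Param → R} {A r : R[X][Y]}
    (h : E.IsNormalForm (E.paramIdeal c) A r) :
    E.IsNormalForm (E.paramIdeal (φ ∘ c)) (A.map (mapRingHom φ)) (r.map (mapRingHom φ)) := by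
  refine ⟨?_, fun a b hab => h.2 a b fun h0 => hab ?_⟩
  · rw [← Polynomial.map_sub]
    exact map_mem_paramIdeal φ h.1
  · rw [coeff_map, coe_mapRingHom, coeff_map, h0, map_zero]

/-- The same monomials represent both quotients, so one ideal cannot lie strictly inside the other.
-/
theorem eq_of_paramIdeal_le [Nontrivial R] {c c' : E.Param → R}
    (h : E.paramIdeal c ≤ E.paramIdeal c') : c = c' := by
  refine paramIdeal_injective (le_antisymm h fun g hg => ?_)
  obtain ⟨r, hr, hs⟩ := E.exists_isNormalForm c g
  have h0 : r = 0 := by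
    refine eq_zero_of_mem_paramIdeal (c := c') ?_ hs
    have := Ideal.sub_mem _ hg (h hr)
    rwa [sub_sub_cancel] at this
  rwa [h0, sub_zero] at hr

theorem _root_.Polynomial.mul_eq_zero_of_mem_ker_mapRingHom {π : R →+* S}
    (h : ∀ a ∈ RingHom.ker π, ∀ b ∈ RingHom.ker π, a * b = 0) :
    ∀ p ∈ RingHom.ker (mapRingHom π), ∀ q ∈ RingHom.ker (mapRingHom π), p * q = 0 := by
  intro p hp q hq
  ext n
  rw [coeff_mul, coeff_zero]
  refine Finset.sum_eq_zero fun x _ => h _ ?_ _ ?_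
  · have := congrArg (fun r => r.coeff x.1) (RingHom.mem_ker.mp hp)
    simpa using this
  · have := congrArg (fun r => r.coeff x.2) (RingHom.mem_ker.mp hq)
    simpa using this

/-- Infinitesimal rigidity: if `I` is a coprime factor of `J`, then the parameters of `I` do not
admit a nontrivial square-zero deformation along which `J` remains in the ideal. -/
theorem eq_of_map_le_paramIdeal [Nontrivial R] {ι : S →+* R} {π : R →+* S}
    (hπι : π.comp ι = RingHom.id S) (hsq : ∀ a ∈ RingHom.ker π, ∀ b ∈ RingHom.ker π, a * b = 0)
    {c : E.Param → S} {c' : E.Param → R} (hc : π ∘ c' = c) {I' : Ideal S[X][Y]}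
    (h_sup : E.paramIdeal c ⊔ I' = ⊤)
    (h_le : (E.paramIdeal c * I').map (mapRingHom (mapRingHom ι)) ≤ E.paramIdeal c') :
    ι ∘ c = c' := by
  have hmod : E.paramIdeal (ι ∘ c) ≤
      E.paramIdeal c' ⊔ RingHom.ker (mapRingHom (mapRingHom π)) := by
    refine Ideal.span_le.mpr ?_
    rintro _ ⟨i, rfl⟩
    rw [← add_sub_cancel (E.basis c' i) (E.basis (ι ∘ c) i)]
    refine Submodule.add_mem_sup (Ideal.subset_span ⟨i, rfl⟩) ?_
    rw [RingHom.mem_ker, map_sub, coe_mapRingHom, basis_map, basis_map, hc,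
      ← Function.comp_assoc, ← RingHom.coe_comp, hπι, RingHom.coe_id, Function.id_comp, sub_self]
  have h1 : (1 : S[X][Y]) ∈ E.paramIdeal c ⊔ I' := h_sup ▸ Submodule.mem_top
  obtain ⟨w, hw, u, hu, hwu⟩ := Submodule.mem_sup.mp h1
  have hw' := map_mem_paramIdeal ι hw
  obtain ⟨a, ha, z, hz, haz⟩ := Submodule.mem_sup.mp (hmod hw')
  have hzz := mul_eq_zero_of_mem_ker_mapRingHom (mul_eq_zero_of_mem_ker_mapRingHom hsq) z hz z hz
  refine eq_of_paramIdeal_le ?_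
  rw [← paramIdeal_map, Ideal.map_le_iff_le_comap]
  intro g hg
  rw [Ideal.mem_comap]
  set φ := mapRingHom (mapRingHom ι)
  have hgu : φ g * φ u ∈ E.paramIdeal c' := by
    rw [← map_mul]
    exact h_le (Ideal.mem_map_of_mem φ (Ideal.mul_mem_mul hg hu))
  have haz' : a + z = φ w := haz
  have hwu' : φ w + φ u = 1 := by rw [← map_add, hwu, map_one]
  -- Modulo the deformed ideal, `φ w = z` and `φ u = 1 - z`, with inverse `1 + z` because `z * z =
  -- 0`.
  have : φ g = (1 + φ w) * (φ g * φ u) + φ g * (φ w + z) * a := by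
    linear_combination (-φ g * (1 + φ w)) * hwu' - φ g * (φ w + z) * haz' + φ g * hzz
  rw [this]
  exact Ideal.add_mem _ (Ideal.mul_mem_left _ _ hgu) (Ideal.mul_mem_left _ _ ha)

end Staircase

/-! ### Jacobian criterion and multiplicity one -/

section SimpleSolutions

variable {K : Type*} [Field K] {ι P : Type*} {F : ι → MvPolynomial P K} {a : P → K}

theorem mem_pointIdeal {p : MvPolynomial P K} : p ∈ pointIdeal a ↔ MvPolynomial.eval a p = 0 :=
  RingHom.mem_ker

/-- The Jacobian criterion, for a system of equations that generates the maximal ideal of a point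
modulo its square. -/
theorem eq_zero_of_jacobianMatrix_mulVec_eq_zero [Fintype P]
    (hF : ∀ i, MvPolynomial.eval a (F i) = 0)
    (h : pointIdeal a ≤ Ideal.span (Set.range F) ⊔ pointIdeal a ^ 2) {v : P → K}
    (hv : (jacobianMatrix F a).mulVec v = 0) : v = 0 := by
  let D : MvPolynomial P K → K := fun g => ∑ p, MvPolynomial.eval a (MvPolynomial.pderiv p g) * v p
  have hadd : ∀ g g', D (g + g') = D g + D g' := fun g g' => by
    simp only [D, map_add, add_mul, Finset.sum_add_distrib]
  have hmul : ∀ g g', D (g * g') = MvPolynomial.eval a g * D g' + MvPolynomial.eval a g' * D g := by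
    intro g g'
    simp only [D, Derivation.leibniz, smul_eq_mul, map_add, map_mul, Finset.mul_sum,
      ← Finset.sum_add_distrib]
    exact Finset.sum_congr rfl fun p _ => by ring
  -- By the product rule, vanishing at `a` together with the derivative `D` along `v` defines an
  -- ideal. It contains the equations and `𝔪²`, hence every `X p - a p`, whose derivative is `v p`.
  let T : Ideal (MvPolynomial P K) :=
    { carrier := {g | MvPolynomial.eval a g = 0 ∧ D g = 0}
      zero_mem' := by simp [D]
      add_mem' := fun {g g'} hg hg' =>
        ⟨by rw [map_add, hg.1, hg'.1, add_zero], by rw [hadd, hg.2, hg'.2, add_zero]⟩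
      smul_mem' := fun g g' hg' =>
        ⟨by rw [smul_eq_mul, map_mul, hg'.1, mul_zero],
          by rw [smul_eq_mul, hmul, hg'.1, hg'.2, mul_zero, zero_mul, add_zero]⟩ }
  have hT : pointIdeal a ≤ T := by
    refine h.trans (sup_le (Ideal.span_le.mpr ?_) ?_)
    · rintro _ ⟨i, rfl⟩
      exact ⟨hF i, congrFun hv i⟩
    · rw [pow_two, Ideal.mul_le]
      intro g hg g' hg'
      rw [mem_pointIdeal] at hg hg'
      exact ⟨by rw [map_mul, hg, zero_mul], by rw [hmul, hg, hg', zero_mul, zero_mul, add_zero]⟩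
  funext p
  classical
  have hp : D (MvPolynomial.X p - MvPolynomial.C (a p)) = 0 :=
    (hT (mem_pointIdeal.mpr (by simp))).2
  simpa [D, MvPolynomial.pderiv_X, Pi.single_apply, apply_ite (MvPolynomial.eval a)] using hp

/-- By Nakayama's lemma the equations generate the maximal ideal of the local ring, so the quotient
is the residue field `K`. -/
theorem solutionMultiplicity_eq_one [Finite P] (hF : ∀ i, MvPolynomial.eval a (F i) = 0)
    (h : pointIdeal a ≤ Ideal.span (Set.range F) ⊔ pointIdeal a ^ 2) :
    solutionMultiplicity F a = 1 := by
  set φ := algebraMap (MvPolynomial P K) (Localization.AtPrime (pointIdeal a))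
  have hmax : (pointIdeal a).map φ =
      IsLocalRing.maximalIdeal (Localization.AtPrime (pointIdeal a)) :=
    Localization.AtPrime.map_eq_maximalIdeal
  have hnoeth : IsNoetherianRing (Localization.AtPrime (pointIdeal a)) :=
    IsLocalization.isNoetherianRing (pointIdeal a).primeCompl _ inferInstance
  have hJ : (Ideal.span (Set.range F)).map φ = (pointIdeal a).map φ := by
    refine le_antisymm (Ideal.map_mono (Ideal.span_le.mpr ?_)) ?_
    · rintro _ ⟨i, rfl⟩
      exact mem_pointIdeal.mpr (hF i)
    · refine Submodule.le_of_le_smul_of_le_jacobson_bot (I := (pointIdeal a).map φ)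
        (IsNoetherian.noetherian _) ?_ ?_
      · rw [IsLocalRing.jacobson_eq_maximalIdeal _ bot_ne_top, hmax]
      · have := Ideal.map_mono (f := φ) h
        rwa [Ideal.map_sup, Ideal.map_pow, pow_two] at this
  have hne : Nontrivial (Localization.AtPrime (pointIdeal a) ⧸
      (Ideal.span (Set.range F)).map φ) := by
    refine Ideal.Quotient.nontrivial_iff.mpr ?_
    rw [hJ, hmax]
    exact Ideal.IsPrime.ne_top'
  rw [solutionMultiplicity, finrank_eq_one_iff_of_nonzero' 1 one_ne_zero]
  intro w
  obtain ⟨w, rfl⟩ := Ideal.Quotient.mk_surjective w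
  obtain ⟨g, s, rfl⟩ := IsLocalization.exists_mk'_eq (pointIdeal a).primeCompl w
  have hs : MvPolynomial.eval a s ≠ 0 := s.2
  -- The fraction `g / s` is congruent to its value at `a`.
  refine ⟨MvPolynomial.eval a g / MvPolynomial.eval a s, ?_⟩
  rw [← map_one (Ideal.Quotient.mk _), ← Ideal.Quotient.mkₐ_eq_mk K, ← map_smul,
    Ideal.Quotient.mkₐ_eq_mk, Ideal.Quotient.eq, Algebra.smul_def, mul_one,
    IsScalarTower.algebraMap_apply K (MvPolynomial P K)]
  rw [← Ideal.mul_unit_mem_iff_mem _ (IsLocalization.map_units _ s), sub_mul,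
    IsLocalization.mk'_spec, ← map_mul, ← map_sub, hJ]
  refine Ideal.mem_map_of_mem _ (mem_pointIdeal.mpr ?_)
  rw [map_sub, map_mul, MvPolynomial.algebraMap_eq, MvPolynomial.eval_C, div_mul_cancel₀ _ hs,
    sub_self]

end SimpleSolutions

/-! ### The equations and their specializations -/

namespace Staircase

variable {E : Staircase} {K : Type*} [Field K]

/-- The equations are the coefficients of the normal forms modulo the generic Gröbner basis over
the polynomial ring. -/
theorem isEquations_iff {t : ℕ} {f : Fin t → K[X][Y]}
    {eqs : Fin t → E.segment → MvPolynomial E.Param K} :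
    E.IsEquations f eqs ↔ ∀ i, ∃ r,
      E.IsNormalForm (E.paramIdeal (MvPolynomial.X : E.Param → MvPolynomial E.Param K))
        ((f i).map (mapRingHom MvPolynomial.C)) r ∧
      ∀ μ : E.segment, eqs i μ = (r.coeff μ.1.2).coeff μ.1.1 := by
  set φ := algebraMap (MvPolynomial E.Param K) (FractionRing (MvPolynomial E.Param K))
  have hinj : Function.Injective φ := IsFractionRing.injective _ _
  have hmap : ∀ (A : K[X][Y]) (r : (MvPolynomial E.Param K)[X][Y]), E.IsNormalForm
      (E.paramIdeal (MvPolynomial.X : E.Param → MvPolynomial E.Param K))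
        (A.map (mapRingHom MvPolynomial.C)) r →
      E.IsNormalForm (E.genericIdeal K)
        (A.map (mapRingHom (algebraMap K (FractionRing (MvPolynomial E.Param K)))))
        (r.map (mapRingHom φ)) := by
    intro A r h
    have := h.map φ
    rwa [Polynomial.map_map, mapRingHom_comp, ← MvPolynomial.algebraMap_eq,
      ← IsScalarTower.algebraMap_eq] at this
  have hcoeff : ∀ (r : (MvPolynomial E.Param K)[X][Y]) a b,
      ((r.map (mapRingHom φ)).coeff b).coeff a = φ ((r.coeff b).coeff a) := by
    intro r a b
    rw [coeff_map, coe_mapRingHom, coeff_map]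
  refine forall_congr' fun i => ⟨?_, ?_⟩
  · rintro ⟨r, hr, hμ⟩
    -- A normal form already exists over `K[Λ]`; by uniqueness over the fraction field it is the
    -- given one.
    obtain ⟨r', hr'⟩ := E.exists_isNormalForm MvPolynomial.X ((f i).map (mapRingHom MvPolynomial.C))
    refine ⟨r', hr', fun μ => hinj ?_⟩
    rw [hμ, ← hcoeff, hr.unique (hmap _ _ hr')]
  · rintro ⟨r, hr, hμ⟩
    refine ⟨_, hmap _ _ hr, fun μ => ?_⟩
    rw [hμ, hcoeff]

theorem existsUnique_isEquations (E : Staircase) {t : ℕ} (f : Fin t → K[X][Y]) :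
    ∃! eqs : Fin t → E.segment → MvPolynomial E.Param K, E.IsEquations f eqs := by
  choose r hr using fun i => E.exists_isNormalForm
    (MvPolynomial.X : E.Param → MvPolynomial E.Param K) ((f i).map (mapRingHom MvPolynomial.C))
  refine ⟨fun i μ => ((r i).coeff μ.1.2).coeff μ.1.1,
    isEquations_iff.mpr fun i => ⟨r i, hr i, fun μ => rfl⟩, fun eqs h => ?_⟩
  funext i μ
  obtain ⟨r', hr', hμ⟩ := isEquations_iff.mp h i
  rw [hμ, hr'.unique (hr i)]

/-- The equations hold at a point exactly when the polynomials lie in the specialized ideal. -/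
theorem IsEquations.forall_eq_zero_iff {R : Type*} [CommRing R] [Nontrivial R] {t : ℕ}
    {f : Fin t → K[X][Y]} {eqs : Fin t → E.segment → MvPolynomial E.Param K}
    (h : E.IsEquations f eqs) (φ : MvPolynomial E.Param K →+* R) (i : Fin t) :
    (∀ μ, φ (eqs i μ) = 0) ↔
      (f i).map (mapRingHom (φ.comp MvPolynomial.C)) ∈ E.paramIdeal (φ ∘ MvPolynomial.X) := by
  obtain ⟨r, hr, hμ⟩ := isEquations_iff.mp h i
  have hφ := hr.map φ
  rw [Polynomial.map_map, mapRingHom_comp] at hφ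
  have hcoeff : ∀ a b, ((r.map (mapRingHom φ)).coeff b).coeff a = φ ((r.coeff b).coeff a) := by
    intro a b
    rw [coeff_map, coe_mapRingHom, coeff_map]
  constructor
  · intro h0
    have hr0 : r.map (mapRingHom φ) = 0 := by
      ext b a
      rw [coeff_zero, coeff_zero, hcoeff]
      by_contra hne
      have hab := hφ.2 a b (by rwa [hcoeff])
      exact hne (by rw [← hμ ⟨(a, b), hab⟩, h0])
    have := hφ.1
    rwa [hr0, sub_zero] at this
  · intro hmem μ
    have h0 : r.map (mapRingHom φ) = 0 := by
      refine eq_zero_of_mem_paramIdeal (c := φ ∘ MvPolynomial.X) ?_ hφ.2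
      have := Ideal.sub_mem _ hmem hφ.1
      rwa [sub_sub_cancel] at this
    rw [hμ, ← hcoeff, h0, coeff_zero, coeff_zero]

theorem IsEquations.eval_eq_zero {t : ℕ} {f : Fin t → K[X][Y]}
    {eqs : Fin t → E.segment → MvPolynomial E.Param K} (h : E.IsEquations f eqs)
    {c : E.Param → K} (hf : ∀ i, f i ∈ E.paramIdeal c) (i : Fin t) (μ : E.segment) :
    MvPolynomial.eval c (eqs i μ) = 0 := by
  refine (h.forall_eq_zero_iff (MvPolynomial.eval c) i).mpr ?_ μ
  have h1 : (MvPolynomial.eval c).comp MvPolynomial.C = RingHom.id K :=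
    RingHom.ext fun x => MvPolynomial.eval_C x
  have h2 : MvPolynomial.eval c ∘ MvPolynomial.X = c := funext fun p => MvPolynomial.eval_X p
  rw [h1, h2, mapRingHom_id, Polynomial.map_id]
  exact hf i

/-- This is rigidity applied to the tautological parameters `φ(Λ)` in the quotient by `T`, a
square-zero extension of `K`. -/
theorem IsEquations.pointIdeal_le {t : ℕ} {f : Fin t → K[X][Y]}
    {eqs : Fin t → E.segment → MvPolynomial E.Param K} (h : E.IsEquations f eqs)
    {c : E.Param → K} {I' : Ideal K[X][Y]} (h_sup : E.paramIdeal c ⊔ I' = ⊤)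
    (h_mul : E.paramIdeal c * I' = Ideal.span (Set.range f)) :
    pointIdeal c ≤ Ideal.span (Set.range fun q : Fin t × E.segment => eqs q.1 q.2) ⊔
      pointIdeal c ^ 2 := by
  have hf : ∀ i, f i ∈ E.paramIdeal c := fun i => by
    refine Ideal.mul_le_left (I := E.paramIdeal c) (J := I') ?_
    rw [h_mul]
    exact Ideal.subset_span (Set.mem_range_self i)
  set T := Ideal.span (Set.range fun q : Fin t × E.segment => eqs q.1 q.2) ⊔
    pointIdeal c ^ 2
  have hTm : T ≤ pointIdeal c := by
    refine sup_le (Ideal.span_le.mpr ?_) (Ideal.pow_le_self two_ne_zero)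
    rintro _ ⟨q, rfl⟩
    exact mem_pointIdeal.mpr (h.eval_eq_zero hf q.1 q.2)
  set φ := Ideal.Quotient.mk T
  let π : MvPolynomial E.Param K ⧸ T →+* K :=
    Ideal.Quotient.lift T (MvPolynomial.eval c) fun p hp => mem_pointIdeal.mp (hTm hp)
  have hπ : ∀ p, π (φ p) = MvPolynomial.eval c p := fun p => Ideal.Quotient.lift_mk _ _ _
  have hnt : Nontrivial (MvPolynomial E.Param K ⧸ T) := π.domain_nontrivial
  have hker : ∀ a ∈ RingHom.ker π, ∀ b ∈ RingHom.ker π, a * b = 0 := by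
    intro a ha b hb
    obtain ⟨a, rfl⟩ := Ideal.Quotient.mk_surjective a
    obtain ⟨b, rfl⟩ := Ideal.Quotient.mk_surjective b
    rw [RingHom.mem_ker] at ha hb
    rw [← map_mul, Ideal.Quotient.eq_zero_iff_mem]
    refine Ideal.mem_sup_right ?_
    rw [pow_two]
    exact Ideal.mul_mem_mul (mem_pointIdeal.mpr ((hπ a).symm.trans ha))
      (mem_pointIdeal.mpr ((hπ b).symm.trans hb))
  have hrigid : (φ.comp MvPolynomial.C) ∘ c = φ ∘ MvPolynomial.X := by
    refine eq_of_map_le_paramIdeal (π := π) ?_ hker ?_ h_sup ?_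
    · ext x
      simp [hπ]
    · funext p
      simp [hπ]
    · rw [h_mul, Ideal.map_span, Ideal.span_le]
      rintro _ ⟨_, ⟨i, rfl⟩, rfl⟩
      refine (h.forall_eq_zero_iff φ i).mp fun μ => ?_
      exact Ideal.Quotient.eq_zero_iff_mem.mpr
        (Ideal.mem_sup_left (Ideal.subset_span ⟨(i, μ), rfl⟩))
  -- Each `Λ_p` becomes the constant `c p`, so `φ` factors through evaluation at `c` and kills
  -- `pointIdeal c`.
  have hφ : φ = (φ.comp MvPolynomial.C).comp (MvPolynomial.eval c) := by
    refine MvPolynomial.ringHom_ext (fun x => ?_) fun p => ?_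
    · simp
    · simpa using (congrFun hrigid p).symm
  intro p hp
  rw [← Ideal.Quotient.eq_zero_iff_mem]
  change φ p = 0
  rw [hφ, RingHom.comp_apply, mem_pointIdeal.mp hp, map_zero]

end Staircase

/-! ### The proposition -/

theorem mainTheorem2 {K : Type*} [Field K] (E : Staircase) {t : ℕ} (f : Fin t → K[X][Y])
    (I I' : Ideal K[X][Y]) (hI : I ∈ E.cell K) (h_sup : I ⊔ I' = ⊤)
    (h_mul : I * I' = Ideal.span (Set.range f)) :
    (∃! c : E.Param → K, E.paramIdeal c = I) ∧
    (∃! eqs : Fin t → E.segment → MvPolynomial E.Param K, E.IsEquations f eqs) ∧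
    ∀ (c : E.Param → K) (eqs : Fin t → E.segment → MvPolynomial E.Param K),
      E.paramIdeal c = I → E.IsEquations f eqs →
      (∀ i μ, MvPolynomial.eval c (eqs i μ) = 0) ∧
      solutionMultiplicity (fun q : Fin t × E.segment => eqs q.1 q.2) c = 1 ∧
      ∀ v : E.Param → K,
        (jacobianMatrix (fun q : Fin t × E.segment => eqs q.1 q.2) c).mulVec v = 0 → v = 0 := by
  refine ⟨?_, E.existsUnique_isEquations f, ?_⟩
  · obtain ⟨c, hc⟩ := Staircase.exists_paramIdeal_eq hI
    refine ⟨c, hc, fun c' hc' => ?_⟩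
    have hcc : E.paramIdeal c' = E.paramIdeal c := Eq.trans hc' hc.symm
    exact Staircase.paramIdeal_injective hcc
  · rintro c eqs rfl h
    have hf : ∀ i, f i ∈ E.paramIdeal c := fun i => by
      refine Ideal.mul_le_left (I := E.paramIdeal c) (J := I') ?_
      rw [h_mul]
      exact Ideal.subset_span (Set.mem_range_self i)
    have h0 := h.eval_eq_zero hf
    have hle := h.pointIdeal_le h_sup h_mul
    have h0' : ∀ q : Fin t × E.segment, MvPolynomial.eval c (eqs q.1 q.2) = 0 :=
      fun q => h0 q.1 q.2
    refine ⟨h0, solutionMultiplicity_eq_one h0' hle, fun v hv => ?_⟩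
    exact eq_zero_of_jacobianMatrix_mulVec_eq_zero
      (F := fun q : Fin t × E.segment => eqs q.1 q.2) h0' hle hv
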